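/- **Setting.** Let $K\ge 2$, widths $n_0,\dots,n_K\ge 1$, $1\le i<K$, and bounds $s_1,\dots,s_K\ge 0$. All vectors in $\mathbb R^{n_k}$ carry the max norm and $\|W\|=\max_a\sum_b|W_{ab}|$ is the induced matrix norm. Let $g_k:\mathbb R^{n_k}\to\mathbb R^{n_k}$ be $1$-Lipschitz activations and let $W_k\in\mathbb R^{n_k\times n_{k-1}}$ satisfy $\|W_k\|\le s_k$ for $1\le k\le K$. The unnormalized network is $h_0(x)=x$, $h_k=g_k(W_kh_{k-1})$, with output $h_K$. The batch-normalized network is $u_0(x)=x$, $u_k=g_k(\mathrm{BN}_k(W_ku_{k-1}))$, with output $u_K$, where $\mathrm{BN}_k(y)_j=(y_j-\mu_{k,j})/\sqrt{\sigma_{k,j}^2+\epsilon}$ with fixed $\epsilon>0$ and fixed (true or estimated) population means $\mu_{k,j}$ and variances $\sigma_{k,j}^2\ge 0$; put $\sigma=\min_{1\le k\le K}\min_j\sqrt{\sigma_{k,j}^2+\epsilon}$. Given a data set $x_1,\dots,x_m$ ($m\ge1$) and a loss $f(v,x)$ that is $L_f$-Lipschitz in the prediction $v\in\mathbb R^{n_K}$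 (for example the $\ell_1$ loss, with $L_f=n_K$), the empirical loss of a model $h$ is $\frac1m\sum_t f(h(x_t),x_t)$. Let $L_{\mathcal H}(w)$ and $L_{\mathcal H_{no}}(w)$, $w\in\mathbb R^{n_i\times n_{i-1}}$, be the empirical losses of the unnormalized and the batch-normalized network in which the layer-$i$ weight matrix is $w$ and all other weights are fixed. Fix a radius $\delta>0$. A point $w$ is an *$\alpha$-stationary point* of a Lipschitz function $F$ on $\mathbb R^{n_i\times n_{i-1}}$ (Euclidean norm $\|\cdot\|_2$) if its Goldstein $\delta$-subdifferential $\operatorname{conv}\bigcup_{\|y-w\|_2\le\delta}\partial F(y)$ contains a vector of Euclidean norm at most $\alpha$, where $\partial F$ is the Clarke subdifferential. A *randomized first-order algorithm* accesses $F$ only through evaluations: each evaluation returns the value of $F$ at a chosen point and, if $F$ is differentiable there, its gradient (otherwise an arbitrary vector); the next point and the final answer depend only on a random seed, the starting point and the earlier evaluations. **Corollary (Convergence rate).** There is a constant $C(d,p)$, depending only on $d$ and $p$, such that the following holds with $d=n_in_{i-1}$ for all data as above, all $\alpha>0$, $\delta>0$, $p\in(0,1)$, $A\ge0$, $\Delta\ge0$.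 Put $c=C(d,p)\,L_fA\Delta/\delta$. 1. There are a number $$N\le c\,\frac{s_{i+1}\cdots s_K}{\alpha^2}$$ and a randomized first-order algorithm which, after $N$ function/gradient evaluations of $L_{\mathcal H}$, returns an $\alpha$-stationary point of $L_{\mathcal H}$ with probability at least $1-p$, whenever $\|h_{i-1}(x_t)\|\le A$ for all $t$ and the starting point $w_0$ satisfies $L_{\mathcal H}(w_0)-\inf L_{\mathcal H}\le\Delta$. 2. For every $\sigma>0$ there are a number $$N\le c\,\frac{\sigma^{-K+i-1}\,s_{i+1}\cdots s_K}{\alpha^2}$$ and a randomized first-order algorithm which, after $N$ function/gradient evaluations of $L_{\mathcal H_{no}}$, returns an $\alpha$-stationary point of $L_{\mathcal H_{no}}$ with probability at least $1-p$, for every batch-normalized network with that value of $\sigma$, whenever $\|u_{i-1}(x_t)\|\le A$ for all $t$ and $L_{\mathcal H_{no}}(w_0)-\inf L_{\mathcal H_{no}}\le\Delta$. $N$ and the algorithm depend only on the widths, $K$, $i$, the $s_k$, $L_f,A,\Delta,\delta,p,\alpha$ (and $\sigma$ in part 2), not on the weights, activations, data, loss, normalization statistics or starting point. -/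

import Mathlib

open Filter Topology MeasureTheory
open scoped NNReal Matrix

noncomputable section

/-! ### Feedforward networks

A vector in `Fin d → ℝ` carries the max norm.  Layers are numbered `1, …, K`; `n k` is the width of
layer `k`, and `n 0` is the dimension of the input. -/

section MatrixNorm

attribute [local instance] Matrix.linftyOpNormedAddCommGroup

/-- The induced infinity norm `max_a ∑_b |A a b|` of a matrix. -/
def matNorm {a b : ℕ} (A : Matrix (Fin a) (Fin b) ℝ) : ℝ := ‖A‖

end MatrixNorm

/-- Weight matrices; `W k` is the matrix of layer `k`, for `k ≥ 1` (`W 0` is never used). -/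
abbrev Weights (n : ℕ → ℕ) : Type :=
  (k : ℕ) → Matrix (Fin (n k)) (Fin (n (k - 1))) ℝ

/-- One self-map of the signal space of each layer (activations, normalization operators).
The maps act on whole vectors, so that activations such as softmax are covered. -/
abbrev LayerMaps (n : ℕ → ℕ) : Type :=
  (k : ℕ) → (Fin (n k) → ℝ) → (Fin (n k) → ℝ)

/-- The output `h_k(x)` of layer `k` of the unnormalized network:
`h_0 = x`, `h_k = g_k (W_k h_{k-1})`. -/
def dnn {n : ℕ → ℕ} (g : LayerMaps n) (W : Weights n) (x : Fin (n 0) → ℝ) :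
    (k : ℕ) → (Fin (n k) → ℝ)
  | 0 => x
  | k + 1 => g (k + 1) (W (k + 1) *ᵥ dnn g W x k)

/-- The output `u_k(x)` of layer `k` of the normalized network:
`u_0 = x`, `u_k = g_k (NO_k (W_k u_{k-1}))`. -/
def normalizedDnn {n : ℕ → ℕ} (g NO : LayerMaps n) (W : Weights n) (x : Fin (n 0) → ℝ) :
    (k : ℕ) → (Fin (n k) → ℝ)
  | 0 => x
  | k + 1 => g (k + 1) (NO (k + 1) (W (k + 1) *ᵥ normalizedDnn g NO W x k))

/-- The norm bounds `‖W_k‖ ≤ s_k`, `1 ≤ k ≤ K`, which define the model families. -/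
def InFamily (K : ℕ) {n : ℕ → ℕ} (s : ℕ → ℝ) (W : Weights n) : Prop :=
  ∀ k, 1 ≤ k → k ≤ K → matNorm (W k) ≤ s k

/-! ### Batch normalization -/

/-- Population (true or estimated) mean and variance of each of the `d` input signals of a
batch normalization layer. -/
structure BNStats (d : ℕ) where
  mean : Fin d → ℝ
  var : Fin d → ℝ
  var_nonneg : ∀ j, 0 ≤ var j

/-- `BN(y, ε)_j = (y_j - μ_j) / √(σ_j² + ε)`. -/
def batchNorm {d : ℕ} (B : BNStats d) (ε : ℝ) (y : Fin d → ℝ) : Fin d → ℝ :=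
  fun j => (y j - B.mean j) / √(B.var j + ε)

/-- `σ` is the least of the numbers `√(σ_{k,j}² + ε)` over all units `j` of all layers
`k = 1, …, K`. -/
def IsLeastDeviation (K : ℕ) {n : ℕ → ℕ} (B : (k : ℕ) → BNStats (n k)) (ε σ : ℝ) : Prop :=
  IsLeast {r : ℝ | ∃ k, 1 ≤ k ∧ k ≤ K ∧ ∃ j : Fin (n k), r = √((B k).var j + ε)} σ

/-! ### The empirical loss as a function of the weights of one layer -/

/-- The space `ℝ^{n_i × n_{i-1}}` of the weights of layer `i`, with the Euclidean norm. -/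
abbrev LayerSpace (n : ℕ → ℕ) (i : ℕ) : Type :=
  EuclideanSpace ℝ (Fin (n i) × Fin (n (i - 1)))

/-- Replace the weight matrix of layer `i` by `w`. -/
def setLayer {n : ℕ → ℕ} (W : Weights n) (i : ℕ) (w : LayerSpace n i) : Weights n :=
  Function.update W i (Matrix.of fun a b => w (a, b))

/-- The empirical loss `(1/m) ∑_t f(h, x_t)` of a model `h` on the data set `x_1, …, x_m`, where
`f v x` is the loss of the prediction `v` at the input `x`. -/
def empiricalLoss {a b m : ℕ} (f : (Fin b → ℝ) → (Fin a → ℝ) → ℝ) (D : Fin m → (Fin a → ℝ))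
    (h : (Fin a → ℝ) → (Fin b → ℝ)) : ℝ :=
  (1 / (m : ℝ)) * ∑ t, f (h (D t)) (D t)

/-- The empirical loss of the unnormalized network as a function of the weights of layer `i`,
the other weights being those of `W`. -/
def lossDnn (K : ℕ) {n : ℕ → ℕ} {m : ℕ} (f : (Fin (n K) → ℝ) → (Fin (n 0) → ℝ) → ℝ)
    (D : Fin m → (Fin (n 0) → ℝ)) (g : LayerMaps n) (W : Weights n) (i : ℕ)
    (w : LayerSpace n i) : ℝ :=
  empiricalLoss f D fun x => dnn g (setLayer W i w) x K

/-- The same for the network with batch normalization at every layer. -/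
def lossBN (K : ℕ) {n : ℕ → ℕ} {m : ℕ} (f : (Fin (n K) → ℝ) → (Fin (n 0) → ℝ) → ℝ)
    (D : Fin m → (Fin (n 0) → ℝ)) (g : LayerMaps n) (B : (k : ℕ) → BNStats (n k)) (ε : ℝ)
    (W : Weights n) (i : ℕ) (w : LayerSpace n i) : ℝ :=
  empiricalLoss f D fun x => normalizedDnn g (fun k => batchNorm (B k) ε) (setLayer W i w) x K

/-! ### Stationarity of Lipschitz functions -/

section Stationarity

variable {E : Type} [NormedAddCommGroup E] [InnerProductSpace ℝ E] [CompleteSpace E]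

/-- The Clarke subdifferential of a locally Lipschitz function on a finite-dimensional space: the
convex hull of the limits of gradients at nearby points of differentiability. -/
def clarkeSubdifferential (F : E → ℝ) (x : E) : Set E :=
  convexHull ℝ {v | ∃ y : ℕ → E, (∀ k, DifferentiableAt ℝ F (y k)) ∧
    Tendsto y atTop (𝓝 x) ∧ Tendsto (fun k => gradient F (y k)) atTop (𝓝 v)}

/-- The Goldstein `δ`-subdifferential. -/
def goldsteinSubdifferential (F : E → ℝ) (δ : ℝ) (x : E) : Set E :=
  convexHull ℝ (⋃ y ∈ Metric.closedBall x δ, clarkeSubdifferential F y)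

/-- `x` is an `α`-stationary point of `F` (at radius `δ`): the Goldstein `δ`-subdifferential of `F`
at `x` contains a vector of Euclidean norm at most `α`. -/
def IsApproxStationary (F : E → ℝ) (δ α : ℝ) (x : E) : Prop :=
  ∃ v ∈ goldsteinSubdifferential F δ x, ‖v‖ ≤ α

/-- A function/gradient oracle for `F`: it returns the value of `F` and, wherever `F` is
differentiable, its gradient (at the other points the vector returned is arbitrary). -/
def IsFirstOrderOracle (F : E → ℝ) (O : E → ℝ × E) : Prop :=
  ∀ x, (O x).1 = F x ∧ (DifferentiableAt ℝ F x → (O x).2 = gradient F x)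

end Stationarity

/-! ### Randomized oracle algorithms -/

/-- A randomized first-order algorithm: it draws a random seed; the next evaluation point and the
final answer depend only on the seed, the starting point and the list of earlier evaluations
(point, value, gradient), the latest one first. -/
structure FirstOrderAlgorithm (E : Type) where
  Seed : Type
  [measurableSpace : MeasurableSpace Seed]
  law : Measure Seed
  [isProbabilityMeasure : IsProbabilityMeasure law]
  query : Seed → E → List (E × ℝ × E) → E
  output : Seed → E → List (E × ℝ × E) → E

attribute [instance] FirstOrderAlgorithm.measurableSpace FirstOrderAlgorithm.isProbabilityMeasure

namespace FirstOrderAlgorithm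

variable {E : Type}

/-- The evaluations made in the first `N` oracle calls. -/
def history (M : FirstOrderAlgorithm E) (O : E → ℝ × E) (x₀ : E) (ω : M.Seed) :
    ℕ → List (E × ℝ × E)
  | 0 => []
  | N + 1 => (M.query ω x₀ (M.history O x₀ ω N), O (M.query ω x₀ (M.history O x₀ ω N))) ::
      M.history O x₀ ω N

/-- The answer of the algorithm after `N` evaluations. -/
def answer (M : FirstOrderAlgorithm E) (O : E → ℝ × E) (x₀ : E) (N : ℕ) (ω : M.Seed) : E :=
  M.output ω x₀ (M.history O x₀ ω N)

/-- Started at `x₀`, after `N` function/gradient evaluations of `F` the algorithm returns an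
`α`-stationary point of `F` (at radius `δ`) with probability at least `1 - p`, whatever the
oracle returns at points of nondifferentiability. -/
def FindsStationary [NormedAddCommGroup E] [InnerProductSpace ℝ E] [CompleteSpace E]
    (M : FirstOrderAlgorithm E) (F : E → ℝ) (δ α p : ℝ) (x₀ : E) (N : ℕ) : Prop :=
  ∀ O : E → ℝ × E, IsFirstOrderOracle F O →
    M.law {ω | ¬ IsApproxStationary F δ α (M.answer O x₀ N ω)} ≤ ENNReal.ofReal p

end FirstOrderAlgorithm

end

/-! Both rates follow from one fact about an `L`-Lipschitz function `F` on a `d`-dimensional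
Euclidean space: `O(L Δ / (δ α²))` evaluations, with a constant depending on `d` and `p`, suffice
for Goldstein stationarity (`exists_firstOrderAlgorithm`). The empirical loss is Lipschitz in the
weights of layer `i`, since each later layer stretches a perturbation by at most `s_j`, and each
normalization from layer `i` on by at most `σ⁻¹` (`norm_dnn_setLayer_sub_le`).

At a nonstationary point `x`, the normalized least-norm element `u` of the closure of the Goldstein
subdifferential satisfies `⟨∇F y, u⟩ ≥ α` wherever `F` is differentiable in the `δ`-ball
(`exists_direction_of_not_isApproxStationary`). Such a direction is sought by cutting planes: the
body `K` of directions in the unit ball with `⟨v, u⟩ ≥ α/2` for all recorded gradients `v` can be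
empty only if `x` is stationary. While `K` is nonempty, its Steiner point gives a trial
displacement. Either `F` drops by more than `δα/16`, and the search restarts at the new point, or
the mean gradient along the randomly perturbed segment has slope at most `α/4` in the trial
direction, so that a sampled gradient cuts off the Steiner point with mean depth at least `α/4`.

The Steiner point is the average of the gradient of the support function. Integration by parts
bounds its movement in nested bodies by the loss of mean width (`inner_steinerPoint_sub_le`), so a
cut costs mean width at least its depth over `2L`. This bound is linear in the gradient and holds
for negative depth too, so only the mean of the sample matters; hence `α²` in the rate. A potential
combining function value and mean width therefore falls by `α/(16L)` on average in each iteration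
(`cuttingPotential_decrease`), and `absorption_bound` converts this into a failure probability.

The oracle is arbitrary where `F` is not differentiable, so no measurability of the run is
available. Gradients are rounded to a countable dense set, and the probabilistic argument needs only
countable subadditivity of outer measures. -/

noncomputable section

/-! ### Absorption times of random walks driven by independent noise -/

section Absorption

variable {X Ω : Type*}

/-- The orbit of `x` under the steps `step · (ω 0), step · (ω 1), …`. -/
def noisyOrbit (step : X → Ω → X) (ω : ℕ → Ω) (x : X) : ℕ → X
  | 0 => x
  | j + 1 => step (noisyOrbit step ω x j) (ω j)

/-- A finite sequence, prolonged by zero. -/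
def prolong [Zero Ω] {J : ℕ} (ω : Fin J → Ω) (j : ℕ) : Ω :=
  if h : j < J then ω ⟨j, h⟩ else 0

lemma noisyOrbit_shift (step : X → Ω → X) (ω : ℕ → Ω) (x : X) (j : ℕ) :
    noisyOrbit step ω x (j + 1) = noisyOrbit step (fun k => ω (k + 1)) (step x (ω 0)) j := by
  induction j with
  | zero => rfl
  | succ j ih => rw [noisyOrbit, ih, noisyOrbit]

lemma prolong_zero [Zero Ω] {J : ℕ} (ω : Fin (J + 1) → Ω) : prolong ω 0 = ω 0 := by
  simp [prolong]

lemma prolong_succ [Zero Ω] {J : ℕ} (ω : Fin (J + 1) → Ω) :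
    (fun k => prolong ω (k + 1)) = prolong (fun j => ω j.succ) := by
  funext k
  simp [prolong]

/-- If a potential decreases on average by `κ` in each step before absorption, the probability of
not being absorbed after `J` steps is at most `Ψ / (κ J)`.  The step is a function of the state
and of a countable code of the noise. -/
theorem absorption_bound [Zero Ω] [MeasurableSpace Ω] (μ : Measure Ω) [IsProbabilityMeasure μ]
    (c : X → Ω → ℕ) (g : X → ℕ → X) (Inv A : X → Prop) (Ψ : X → ENNReal) (κ : ENNReal)
    (habs : ∀ x, A x → ∀ k, g x k = x)
    (hinv : ∀ x, Inv x → ¬ A x → ∀ k, μ {ω | c x ω = k} ≠ 0 → Inv (g x k))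
    (hdec : ∀ x, Inv x → ¬ A x → κ + ∑' k, μ {ω | c x ω = k} * Ψ (g x k) ≤ Ψ x)
    (J : ℕ) (x : X) (hx : Inv x) :
    J * κ * (Measure.pi fun _ : Fin J => μ)
      {ω | ¬ (Inv (noisyOrbit (fun x ω => g x (c x ω)) (prolong ω) x J) ∧
        A (noisyOrbit (fun x ω => g x (c x ω)) (prolong ω) x J))} ≤ Ψ x := by
  set step : X → Ω → X := fun x ω => g x (c x ω) with hstep
  -- The first noise variable is split off, so that the induction hypothesis applies to the state
  -- after one step.
  induction J generalizing x with
  | zero => simp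
  | succ J ih =>
    by_cases hA : A x
    · have hfix : ∀ (ω : ℕ → Ω) j, noisyOrbit step ω x j = x := by
        intro ω j
        induction j with
        | zero => rfl
        | succ j ih => rw [noisyOrbit, ih]; exact habs x hA _
      simp [hfix, hA, hx]
    · set B : (j : ℕ) → X → Set (Fin j → Ω) := fun j x =>
        {ω | ¬ (Inv (noisyOrbit step (prolong ω) x j) ∧ A (noisyOrbit step (prolong ω) x j))}
      have hrec : (Measure.pi fun _ : Fin (J + 1) => μ) (B (J + 1) x) ≤
          ∑' k, μ {ω | c x ω = k} * (Measure.pi fun _ : Fin J => μ) (B J (g x k)) := by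
        have hmp := measurePreserving_piFinSuccAbove (fun _ : Fin (J + 1) => μ) 0
        have hset : B (J + 1) x = (MeasurableEquiv.piFinSuccAbove (fun _ : Fin (J + 1) => Ω) 0) ⁻¹'
            {q | q.2 ∈ B J (step x q.1)} := by
          ext ω
          simp only [B, Set.mem_ofPred_eq, Set.mem_preimage, noisyOrbit_shift, prolong_zero,
            prolong_succ]
          rfl
        rw [hset, hmp.measure_preimage_equiv]
        -- Covering by countably many rectangles, one for each code, requires no measurability of
        -- the failure set.
        calc _ ≤ (μ.prod (Measure.pi fun _ : Fin J => μ))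
              (⋃ k, {ω | c x ω = k} ×ˢ B J (g x k)) := by
              apply measure_mono
              rintro ⟨ω, ω'⟩ h
              exact Set.mem_iUnion.2 ⟨c x ω, rfl, h⟩
          _ ≤ ∑' k, (μ.prod (Measure.pi fun _ : Fin J => μ))
              ({ω | c x ω = k} ×ˢ B J (g x k)) := measure_iUnion_le _
          _ = _ := by simp only [Measure.prod_prod]
      -- One of the `J + 1` copies is bounded by `κ`; the other `J` go through the recursion.
      calc ((J + 1 : ℕ) : ENNReal) * κ * (Measure.pi fun _ : Fin (J + 1) => μ) (B (J + 1) x)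
          = κ * (Measure.pi fun _ : Fin (J + 1) => μ) (B (J + 1) x) +
            J * κ * (Measure.pi fun _ : Fin (J + 1) => μ) (B (J + 1) x) := by
              push_cast; ring
        _ ≤ κ * 1 + J * κ * ∑' k, μ {ω | c x ω = k} *
              (Measure.pi fun _ : Fin J => μ) (B J (g x k)) := by
              gcongr
              exact prob_le_one
        _ = κ + ∑' k, μ {ω | c x ω = k} *
              (J * κ * (Measure.pi fun _ : Fin J => μ) (B J (g x k))) := by
              rw [← ENNReal.tsum_mul_left, mul_one]
              congr 2
              funext k
              ring
        _ ≤ κ + ∑' k, μ {ω | c x ω = k} * Ψ (g x k) := by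
              refine add_le_add le_rfl (ENNReal.tsum_le_tsum fun k => ?_)
              by_cases hk : μ {ω | c x ω = k} = 0
              · simp [hk]
              · gcongr
                exact ih _ (hinv x hx hA k hk)
        _ ≤ Ψ x := hdec x hx hA

end Absorption

/-! ### Gradients of Lipschitz functions -/

section LipschitzGradient

variable {E : Type} [NormedAddCommGroup E] [InnerProductSpace ℝ E] [FiniteDimensional ℝ E]

lemma norm_gradient_le_of_lipschitz {F : E → ℝ} {L : ℝ≥0} (hF : LipschitzWith L F) (x : E) :
    ‖gradient F x‖ ≤ L := by
  rw [gradient, LinearIsometryEquiv.norm_map]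
  exact norm_fderiv_le_of_lipschitz ℝ hF

lemma measurable_gradient [MeasurableSpace E] [BorelSpace E] (F : E → ℝ) :
    Measurable (gradient F) :=
  (InnerProductSpace.toDual ℝ E).symm.continuous.measurable.comp (measurable_fderiv ℝ F)

lemma inner_gradient_eq_lineDeriv {F : E → ℝ} {x : E} (hF : DifferentiableAt ℝ F x) (v : E) :
    inner ℝ (gradient F x) v = lineDeriv ℝ F x v := by
  rw [inner_gradient_left, hF.lineDeriv_eq_fderiv]

end LipschitzGradient

/-! ### The Steiner point -/

section Tent

variable {E : Type} [NormedAddCommGroup E]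

/-- The tent function `max (1 - ‖x‖) 0`. -/
def tent (x : E) : ℝ := max (1 - ‖x‖) 0

lemma tent_nonneg (x : E) : 0 ≤ tent x := le_max_right _ _

lemma lipschitzWith_tent : LipschitzWith 1 (tent : E → ℝ) := by
  have h : LipschitzWith 1 (fun x : E => 1 - ‖x‖) := by
    refine LipschitzWith.of_le_add fun x y => ?_
    have := norm_sub_norm_le y x
    rw [dist_comm, dist_eq_norm]
    linarith
  exact h.max_const 0

lemma tent_eq_zero {x : E} (hx : x ∉ Metric.closedBall (0 : E) 1) : tent x = 0 := by
  have : 1 < ‖x‖ := by simpa using hx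
  exact max_eq_right (by linarith)

end Tent

section Steiner

variable {E : Type} [NormedAddCommGroup E] [InnerProductSpace ℝ E]

/-- The support function of a set. -/
def supportFunction (K : Set E) (θ : E) : ℝ := sSup ((fun y => inner ℝ y θ) '' K)

lemma inner_le_norm_of_mem_unitBall {y : E} (hy : y ∈ Metric.closedBall (0 : E) 1) (θ : E) :
    inner ℝ y θ ≤ ‖θ‖ := by
  have h1 : ‖y‖ ≤ 1 := by simpa using hy
  exact (real_inner_le_norm y θ).trans (mul_le_of_le_one_left (norm_nonneg θ) h1)

lemma inner_le_supportFunction {K : Set E} (hK : K ⊆ Metric.closedBall 0 1) {y : E} (hy : y ∈ K)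
    (θ : E) : inner ℝ y θ ≤ supportFunction K θ := by
  refine le_csSup ⟨‖θ‖, ?_⟩ ⟨y, hy, rfl⟩
  rintro _ ⟨z, hz, rfl⟩
  exact inner_le_norm_of_mem_unitBall (hK hz) θ

lemma supportFunction_le {K : Set E} (hne : K.Nonempty) {θ : E} {r : ℝ}
    (h : ∀ y ∈ K, inner ℝ y θ ≤ r) : supportFunction K θ ≤ r := by
  refine csSup_le (hne.image _) ?_
  rintro _ ⟨z, hz, rfl⟩
  exact h z hz

lemma supportFunction_mono {K K' : Set E} (hK : K ⊆ Metric.closedBall 0 1) (hK' : K' ⊆ K)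
    (hne : K'.Nonempty) (θ : E) : supportFunction K' θ ≤ supportFunction K θ :=
  supportFunction_le hne fun _ hy => inner_le_supportFunction hK (hK' hy) θ

lemma lipschitzWith_supportFunction {K : Set E} (hK : K ⊆ Metric.closedBall 0 1)
    (hne : K.Nonempty) : LipschitzWith 1 (supportFunction K) := by
  refine LipschitzWith.of_le_add fun θ θ' => supportFunction_le hne fun y hy => ?_
  have h1 := inner_le_supportFunction hK hy θ'
  have h2 := inner_le_norm_of_mem_unitBall (hK hy) (θ - θ')
  rw [inner_sub_right] at h2
  rw [dist_eq_norm]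
  linarith

lemma abs_supportFunction_le {K : Set E} (hK : K ⊆ Metric.closedBall 0 1) (hne : K.Nonempty)
    (θ : E) : |supportFunction K θ| ≤ ‖θ‖ := by
  refine abs_le.2 ⟨?_, supportFunction_le hne fun y hy => inner_le_norm_of_mem_unitBall (hK hy) θ⟩
  obtain ⟨y, hy⟩ := hne
  have h1 := inner_le_supportFunction hK hy θ
  have h2 := inner_le_norm_of_mem_unitBall (hK hy) (-θ)
  rw [inner_neg_right, norm_neg] at h2
  linarith

/-- The gradient of the support function of a compact set lies in the set. -/
lemma gradient_supportFunction_mem [CompleteSpace E] {K : Set E} (hK : K ⊆ Metric.closedBall 0 1)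
    (hc : IsCompact K) (hne : K.Nonempty) {θ : E}
    (hd : DifferentiableAt ℝ (supportFunction K) θ) : gradient (supportFunction K) θ ∈ K := by
  obtain ⟨y, hy, hmax⟩ := hc.exists_isMaxOn hne
    (f := fun y => inner ℝ y θ) (by fun_prop)
  have hval : supportFunction K θ = inner ℝ y θ :=
    le_antisymm (supportFunction_le hne fun z hz => hmax hz) (inner_le_supportFunction hK hy θ)
  -- The difference is nonnegative and vanishes at `θ`, where `y` attains the supremum; hence the
  -- gradient at `θ` is `y`.
  have hmin : IsLocalMin (fun w => supportFunction K w - inner ℝ y w) θ := by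
    refine Filter.Eventually.of_forall fun w => ?_
    have := inner_le_supportFunction hK hy w
    change supportFunction K θ - inner ℝ y θ ≤ supportFunction K w - inner ℝ y w
    linarith
  have hder : HasFDerivAt (fun w => supportFunction K w - inner ℝ y w)
      (fderiv ℝ (supportFunction K) θ - innerSL ℝ y) θ :=
    hd.hasFDerivAt.sub (innerSL ℝ y).hasFDerivAt
  have h0 := hmin.hasFDerivAt_eq_zero hder
  have : gradient (supportFunction K) θ = y := by
    refine ext_inner_right ℝ fun w => ?_
    have := congrArg (fun T : E →L[ℝ] ℝ => T w) h0
    simp only [sub_apply, innerSL_apply_apply, zero_apply]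
      at this
    rw [inner_gradient_left]
    linarith
  rwa [this]

lemma hasCompactSupport_tent [FiniteDimensional ℝ E] : HasCompactSupport (tent : E → ℝ) :=
  HasCompactSupport.intro (isCompact_closedBall 0 1) fun _ hx => tent_eq_zero hx

lemma lineDeriv_tent_eq_zero {x : E} (hx : x ∉ Metric.closedBall (0 : E) 1) (v : E) :
    lineDeriv ℝ (tent : E → ℝ) x v = 0 := by
  have h : (tent : E → ℝ) =ᶠ[𝓝 x] fun _ => 0 := by
    filter_upwards [Metric.isClosed_closedBall.isOpen_compl.mem_nhds hx] with y hy
    exact tent_eq_zero hy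
  rw [h.lineDeriv_eq]
  simp [lineDeriv]

variable [FiniteDimensional ℝ E] [MeasurableSpace E] [BorelSpace E]
  (μ : Measure E) [μ.IsAddHaarMeasure]

lemma integrable_tent : Integrable (tent : E → ℝ) μ :=
  lipschitzWith_tent.continuous.integrable_of_hasCompactSupport hasCompactSupport_tent

/-- The tent is at least `1/2` on the ball of radius `1/2`, whose volume is `2 ^ (-d)` times that of
the unit ball. -/
lemma le_integral_tent :
    μ.real (Metric.closedBall 0 1) ≤ 2 ^ (Module.finrank ℝ E + 1) * ∫ x, tent x ∂μ := by
  have h1 : (1 / 2 : ℝ) * μ.real (Metric.closedBall 0 (1 / 2)) ≤ ∫ x, tent x ∂μ := by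
    calc (1 / 2 : ℝ) * μ.real (Metric.closedBall 0 (1 / 2))
        = ∫ x in Metric.closedBall (0 : E) (1 / 2), (1 / 2 : ℝ) ∂μ := by
          simp [mul_comm]
      _ ≤ ∫ x in Metric.closedBall (0 : E) (1 / 2), tent x ∂μ := by
          refine setIntegral_mono_on (integrableOn_const (isCompact_closedBall 0 _).measure_ne_top)
            (integrable_tent μ).integrableOn measurableSet_closedBall fun x hx => ?_
          have : ‖x‖ ≤ 1 / 2 := by simpa using hx
          exact le_max_of_le_left (by linarith)
      _ ≤ ∫ x, tent x ∂μ :=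
          setIntegral_le_integral (integrable_tent μ) (Eventually.of_forall tent_nonneg)
  rw [Measure.addHaar_real_closedBall' μ 0 (by norm_num)] at h1
  calc μ.real (Metric.closedBall 0 1) = 2 ^ (Module.finrank ℝ E + 1) *
        ((1 / 2) * ((1 / 2) ^ Module.finrank ℝ E * μ.real (Metric.closedBall 0 1))) := by
        rw [pow_succ, one_div, inv_pow]; field_simp
    _ ≤ _ := by gcongr

lemma integral_tent_pos : 0 < ∫ x : E, tent x ∂μ := by
  have h1 := le_integral_tent μ
  have h2 : 0 < μ.real (Metric.closedBall (0 : E) 1) :=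
    ENNReal.toReal_pos (Metric.measure_closedBall_pos μ 0 one_pos).ne'
      (isCompact_closedBall 0 1).measure_ne_top
  by_contra! h
  have : (2 : ℝ) ^ (Module.finrank ℝ E + 1) * ∫ x : E, tent x ∂μ ≤ 0 :=
    mul_nonpos_of_nonneg_of_nonpos (by positivity) h
  linarith

/-- A Steiner point of a convex body: the average of the gradient of its support function. -/
def steinerPoint (K : Set E) : E :=
  (∫ x : E, tent x ∂μ)⁻¹ • ∫ x, tent x • gradient (supportFunction K) x ∂μ

/-- The mean width of a convex body, normalized as required for `steinerPoint`. -/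
def meanWidth (K : Set E) : ℝ :=
  (∫ x : E, tent x ∂μ)⁻¹ * ∫ x in Metric.closedBall (0 : E) 1, supportFunction K x ∂μ

variable {μ}

lemma integrable_tent_smul_gradient {K : Set E} (hK : K ⊆ Metric.closedBall 0 1)
    (hne : K.Nonempty) : Integrable (fun x => tent x • gradient (supportFunction K) x) μ :=
  (integrable_tent μ).smul_bdd 1 (measurable_gradient _).aestronglyMeasurable
    (Eventually.of_forall fun x => by
      simpa using norm_gradient_le_of_lipschitz (lipschitzWith_supportFunction hK hne) x)

lemma inner_steinerPoint {K : Set E} (hK : K ⊆ Metric.closedBall 0 1)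
    (hne : K.Nonempty) (v : E) : inner ℝ v (steinerPoint μ K) =
      (∫ x : E, tent x ∂μ)⁻¹ * ∫ x, tent x * inner ℝ v (gradient (supportFunction K) x) ∂μ := by
  rw [steinerPoint, inner_smul_right, ← integral_inner (integrable_tent_smul_gradient hK hne)]
  simp only [inner_smul_right]

/-- The Steiner point satisfies the linear inequalities which the body satisfies. -/
lemma le_inner_steinerPoint {K : Set E} (hK : K ⊆ Metric.closedBall 0 1) (hc : IsCompact K)
    (hne : K.Nonempty) {v : E} {r : ℝ} (h : ∀ y ∈ K, r ≤ inner ℝ v y) :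
    r ≤ inner ℝ v (steinerPoint μ K) := by
  rw [inner_steinerPoint hK hne, inv_mul_eq_div, le_div_iff₀ (integral_tent_pos μ),
    ← integral_const_mul]
  have hint := (integrable_tent_smul_gradient (μ := μ) hK hne).const_inner (𝕜 := ℝ) v
  simp only [inner_smul_right] at hint
  refine integral_mono_ae ((integrable_tent μ).const_mul r) hint ?_
  filter_upwards [(lipschitzWith_supportFunction hK hne).ae_differentiableAt (μ := μ)] with x hx
  change r * tent x ≤ tent x * _
  rw [mul_comm]
  exact mul_le_mul_of_nonneg_left (h _ (gradient_supportFunction_mem hK hc hne hx)) (tent_nonneg x)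

lemma norm_steinerPoint_le {K : Set E} (hK : K ⊆ Metric.closedBall 0 1) (hc : IsCompact K)
    (hne : K.Nonempty) : ‖steinerPoint μ K‖ ≤ 1 := by
  set s := steinerPoint μ K with hs
  by_cases h0 : s = 0
  · simp [h0]
  have h := le_inner_steinerPoint (μ := μ) hK hc hne (v := -s) (r := -‖s‖) fun y hy => by
    have := inner_le_norm_of_mem_unitBall (hK hy) s
    rw [inner_neg_left, real_inner_comm]
    linarith
  rw [← hs, inner_neg_left, real_inner_self_eq_norm_sq] at h
  have hpos : 0 < ‖s‖ := norm_pos_iff.2 h0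
  nlinarith

/-- Integration by parts: the movement of the Steiner point in nested convex bodies is bounded by
the decrease of the mean width. -/
lemma inner_steinerPoint_sub_le {K K' : Set E} (hK : K ⊆ Metric.closedBall 0 1) (hK' : K' ⊆ K)
    (hne : K'.Nonempty) (v : E) :
    inner ℝ v (steinerPoint μ K') - inner ℝ v (steinerPoint μ K) ≤
      ‖v‖ * (meanWidth μ K - meanWidth μ K') := by
  have hneK := hne.mono hK'
  have hZ := integral_tent_pos (E := E) μ
  -- The derivative is moved onto the tent, which is Lipschitz and compactly supported, so no
  -- boundary term arises. What remains is the support function against a weight of size at most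
  -- `‖v‖` on the unit ball.
  have hparts : ∀ S : Set E, S ⊆ Metric.closedBall 0 1 → S.Nonempty →
      inner ℝ v (steinerPoint μ S) = (∫ x : E, tent x ∂μ)⁻¹ *
        ∫ x in Metric.closedBall (0 : E) 1, lineDeriv ℝ tent x (-v) * supportFunction S x ∂μ := by
    intro S hS hSne
    have hlip := lipschitzWith_supportFunction hS hSne
    rw [inner_steinerPoint hS hSne]
    congr 1
    calc _ = ∫ x, lineDeriv ℝ (supportFunction S) x v * tent x ∂μ := by
          refine integral_congr_ae ?_
          filter_upwards [hlip.ae_differentiableAt (μ := μ)] with x hx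
          rw [← inner_gradient_eq_lineDeriv hx, real_inner_comm, mul_comm]
      _ = ∫ x, lineDeriv ℝ tent x (-v) * supportFunction S x ∂μ :=
          hlip.integral_lineDeriv_mul_eq lipschitzWith_tent hasCompactSupport_tent v
      _ = _ := by
          rw [setIntegral_eq_integral_of_forall_compl_eq_zero]
          intro x hx
          rw [lineDeriv_tent_eq_zero hx, zero_mul]
  have hint : ∀ S : Set E, S ⊆ Metric.closedBall 0 1 → S.Nonempty →
      IntegrableOn (supportFunction S) (Metric.closedBall 0 1) μ := fun S hS hSne =>
    (lipschitzWith_supportFunction hS hSne).continuous.continuousOn.integrableOn_compact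
      (isCompact_closedBall 0 1)
  have hbd : ∀ x, ‖lineDeriv ℝ (tent : E → ℝ) x (-v)‖ ≤ ‖v‖ := fun x => by
    simpa using norm_lineDeriv_le_of_lipschitz ℝ (lipschitzWith_tent (E := E)) (x₀ := x) (v := -v)
  have hint' : ∀ S : Set E, S ⊆ Metric.closedBall 0 1 → S.Nonempty →
      IntegrableOn (fun x => lineDeriv ℝ tent x (-v) * supportFunction S x)
        (Metric.closedBall 0 1) μ := fun S hS hSne =>
    (hint S hS hSne).bdd_mul
      (aestronglyMeasurable_lineDeriv lipschitzWith_tent.continuous _)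
      (Eventually.of_forall hbd)
  rw [hparts K' (hK'.trans hK) hne, hparts K hK hneK, meanWidth, meanWidth, ← mul_sub, ← mul_sub,
    mul_left_comm ‖v‖, ← integral_sub (hint K hK hneK) (hint K' (hK'.trans hK) hne),
    ← integral_sub (hint' K' (hK'.trans hK) hne) (hint' K hK hneK)]
  refine mul_le_mul_of_nonneg_left ?_ (inv_nonneg.2 hZ.le)
  rw [← integral_const_mul]
  refine integral_mono ((hint' K' (hK'.trans hK) hne).sub (hint' K hK hneK))
    (((hint K hK hneK).sub (hint K' (hK'.trans hK) hne)).const_mul _) fun x => ?_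
  have h1 := supportFunction_mono hK hK' hne x
  have h2 := (abs_le.1 (hbd x)).1
  change _ - _ ≤ ‖v‖ * (_ - _)
  nlinarith

lemma meanWidth_mono {K K' : Set E} (hK : K ⊆ Metric.closedBall 0 1) (hK' : K' ⊆ K)
    (hne : K'.Nonempty) : meanWidth μ K' ≤ meanWidth μ K := by
  refine mul_le_mul_of_nonneg_left ?_ (inv_nonneg.2 (integral_tent_pos μ).le)
  refine integral_mono ?_ ?_ (supportFunction_mono hK hK' hne)
  · exact (lipschitzWith_supportFunction (hK'.trans hK) hne).continuous.continuousOn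
      |>.integrableOn_compact (isCompact_closedBall 0 1)
  · exact (lipschitzWith_supportFunction hK (hne.mono hK')).continuous.continuousOn
      |>.integrableOn_compact (isCompact_closedBall 0 1)

lemma abs_meanWidth_le {K : Set E} (hK : K ⊆ Metric.closedBall 0 1) (hne : K.Nonempty) :
    |meanWidth μ K| ≤ 2 ^ (Module.finrank ℝ E + 1) := by
  have hZ := integral_tent_pos (E := E) μ
  have h : ‖∫ x in Metric.closedBall (0 : E) 1, supportFunction K x ∂μ‖ ≤
      1 * μ.real (Metric.closedBall 0 1) := by
    refine norm_setIntegral_le_of_norm_le_const (isCompact_closedBall 0 1).measure_lt_top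
      fun x hx => ?_
    exact (abs_supportFunction_le hK hne x).trans (by simpa using hx)
  rw [meanWidth, abs_mul, abs_of_pos (inv_pos.2 hZ), inv_mul_eq_div, div_le_iff₀ hZ]
  rw [one_mul] at h
  exact h.trans (le_integral_tent μ)

end Steiner

/-! ### Averages of gradients along randomly perturbed segments -/

section Sampling

variable {E : Type} [NormedAddCommGroup E] [InnerProductSpace ℝ E] [FiniteDimensional ℝ E]
  [MeasurableSpace E] [BorelSpace E]

/-- The joint law of a uniform time in `[0, 1]` and a uniform vector in the ball of radius `η`. -/
def segmentNoise (μ : Measure E) (η : ℝ) : Measure (ℝ × E) :=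
  (volume.restrict (Set.Icc (0 : ℝ) 1)).prod (ProbabilityTheory.cond μ (Metric.closedBall 0 η))

/-- A point of the segment from `x` to `x - w`, translated by a random vector. -/
def samplePoint (x w : E) (ω : ℝ × E) : E := x + ω.2 - ω.1 • w

instance : IsProbabilityMeasure (volume.restrict (Set.Icc (0 : ℝ) 1)) := ⟨by simp⟩

variable (μ : Measure E) [μ.IsAddHaarMeasure]

omit [BorelSpace E] in
lemma isProbabilityMeasure_cond_closedBall {η : ℝ} (hη : 0 < η) :
    IsProbabilityMeasure (ProbabilityTheory.cond μ (Metric.closedBall (0 : E) η)) :=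
  ProbabilityTheory.cond_isProbabilityMeasure_of_finite
    (Metric.measure_closedBall_pos μ 0 hη).ne' (isCompact_closedBall 0 η).measure_ne_top

omit [BorelSpace E] in
lemma isProbabilityMeasure_segmentNoise {η : ℝ} (hη : 0 < η) :
    IsProbabilityMeasure (segmentNoise μ η) := by
  have := isProbabilityMeasure_cond_closedBall μ hη
  unfold segmentNoise
  infer_instance

lemma measurable_samplePoint (x w : E) : Measurable (samplePoint x w) := by
  unfold samplePoint
  fun_prop

variable {μ}

lemma ae_cond_closedBall_differentiableAt {F : E → ℝ} {L : ℝ≥0} (hF : LipschitzWith L F) (η : ℝ)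
    (a : E) : ∀ᵐ y ∂ProbabilityTheory.cond μ (Metric.closedBall (0 : E) η),
      DifferentiableAt ℝ F (a + y) := by
  refine ProbabilityTheory.cond_absolutelyContinuous ?_
  exact (quasiMeasurePreserving_add_left μ a).ae (hF.ae_differentiableAt (μ := μ))

lemma ae_segmentNoise_mem {η : ℝ} (hη : 0 < η) :
    ∀ᵐ ω ∂segmentNoise μ η, ω.1 ∈ Set.Icc (0 : ℝ) 1 ∧ ‖ω.2‖ ≤ η := by
  have := isProbabilityMeasure_cond_closedBall μ hη
  have h1 : ∀ᵐ t ∂volume.restrict (Set.Icc (0 : ℝ) 1), t ∈ Set.Icc (0 : ℝ) 1 :=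
    ae_restrict_mem measurableSet_Icc
  have h2 : ∀ᵐ y ∂ProbabilityTheory.cond μ (Metric.closedBall (0 : E) η), ‖y‖ ≤ η := by
    filter_upwards [ProbabilityTheory.ae_cond_mem (μ := μ)
      (measurableSet_closedBall (x := (0 : E)) (ε := η))] with y hy
    simpa using hy
  exact (Measure.quasiMeasurePreserving_fst.ae h1).and (Measure.quasiMeasurePreserving_snd.ae h2)

/-- Rademacher's theorem at each fixed time, the perturbation having a density, followed by Fubini.
An unperturbed segment could lie entirely in the null set of nondifferentiability. -/
lemma ae_differentiableAt_samplePoint {F : E → ℝ} {L : ℝ≥0} (hF : LipschitzWith L F) {η : ℝ}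
    (hη : 0 < η) (x w : E) :
    ∀ᵐ ω ∂segmentNoise μ η, DifferentiableAt ℝ F (samplePoint x w ω) := by
  have := isProbabilityMeasure_cond_closedBall μ hη
  have hm : MeasurableSet {ω : ℝ × E | DifferentiableAt ℝ F (samplePoint x w ω)} :=
    measurable_samplePoint x w (measurableSet_of_differentiableAt ℝ F)
  refine (Measure.ae_prod_iff_ae_ae hm).2 (Eventually.of_forall fun t => ?_)
  filter_upwards [ae_cond_closedBall_differentiableAt hF η (x - t • w)] with y hy
  rwa [samplePoint, add_sub_right_comm]

omit [FiniteDimensional ℝ E] [MeasurableSpace E] [BorelSpace E] in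
lemma samplePoint_mem_closedBall {δ η : ℝ} {x w : E} (hw : ‖w‖ + η ≤ δ) {ω : ℝ × E}
    (hω : ω.1 ∈ Set.Icc (0 : ℝ) 1 ∧ ‖ω.2‖ ≤ η) : samplePoint x w ω ∈ Metric.closedBall x δ := by
  rw [mem_closedBall_iff_norm, samplePoint, show x + ω.2 - ω.1 • w - x = ω.2 - ω.1 • w by abel]
  have h1 : ‖ω.1 • w‖ ≤ ‖w‖ := by
    rw [norm_smul, Real.norm_of_nonneg hω.1.1]
    exact mul_le_of_le_one_left (norm_nonneg w) hω.1.2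
  linarith [norm_sub_le ω.2 (ω.1 • w), hω.2]

lemma integrable_inner_gradient_samplePoint {F : E → ℝ} {L : ℝ≥0} (hF : LipschitzWith L F) {η : ℝ}
    (hη : 0 < η) (x w u : E) :
    Integrable (fun ω => inner ℝ (gradient F (samplePoint x w ω)) u) (segmentNoise μ η) := by
  have := isProbabilityMeasure_segmentNoise μ hη
  have hm : Measurable fun ω => gradient F (samplePoint x w ω) :=
    (measurable_gradient F).comp (measurable_samplePoint x w)
  refine Integrable.of_bound (hm.inner_const).aestronglyMeasurable (L * ‖u‖)
    (Eventually.of_forall fun ω => ?_)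
  exact (norm_inner_le_norm _ _).trans
    (mul_le_mul_of_nonneg_right (norm_gradient_le_of_lipschitz hF _) (norm_nonneg u))

omit [MeasurableSpace E] [BorelSpace E] in
-- The restriction of `F` to the segment is Lipschitz, hence absolutely continuous, and the
-- fundamental theorem of calculus applies.
lemma integral_inner_gradient_segment {F : E → ℝ} {L : ℝ≥0} (hF : LipschitzWith L F) (a w : E)
    (hd : ∀ᵐ t ∂volume.restrict (Set.Icc (0 : ℝ) 1), DifferentiableAt ℝ F (a - t • w)) :
    ∫ t in Set.Icc (0 : ℝ) 1, inner ℝ (gradient F (a - t • w)) w = F a - F (a - w) := by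
  have hlip : LipschitzWith (L * ‖w‖₊) fun t : ℝ => F (a - t • w) := by
    refine hF.comp (LipschitzWith.of_dist_le_mul fun s t => ?_)
    rw [dist_sub_left, dist_eq_norm, ← sub_smul, norm_smul, dist_eq_norm, mul_comm]
    rfl
  have hac := (hlip.lipschitzOnWith (s := Set.uIcc 0 1)).absolutelyContinuousOnInterval
  have hftc := hac.integral_deriv_eq_sub
  simp only [zero_smul, sub_zero, one_smul] at hftc
  rw [integral_Icc_eq_integral_Ioc, ← intervalIntegral.integral_of_le zero_le_one,
    ← neg_sub, ← hftc, ← intervalIntegral.integral_neg]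
  rw [ae_restrict_iff' measurableSet_Icc] at hd
  refine intervalIntegral.integral_congr_ae ?_
  filter_upwards [hd] with t ht hmem
  rw [Set.uIoc_of_le zero_le_one] at hmem
  have h1 : HasDerivAt (fun t : ℝ => a - t • w) (-w) t := by
    simpa using ((hasDerivAt_id t).smul_const w).const_sub a
  have h2 := (ht (Set.Ioc_subset_Icc_self hmem)).hasFDerivAt.comp_hasDerivAt t h1
  rw [inner_gradient_left]
  have h3 : deriv (fun t : ℝ => F (a - t • w)) t = _ := h2.deriv
  rw [h3, map_neg, neg_neg]

/-- The mean slope along a randomly perturbed segment is close to the slope of the segment. -/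
lemma integral_inner_gradient_samplePoint_le {F : E → ℝ} {L : ℝ≥0} (hF : LipschitzWith L F)
    {η : ℝ} (hη : 0 < η) (x w : E) :
    ∫ ω, inner ℝ (gradient F (samplePoint x w ω)) w ∂segmentNoise μ η ≤
      F x - F (x - w) + 2 * L * η := by
  have hp := isProbabilityMeasure_cond_closedBall μ hη
  have hm : MeasurableSet {ω : ℝ × E | DifferentiableAt ℝ F (samplePoint x w ω)} :=
    measurable_samplePoint x w (measurableSet_of_differentiableAt ℝ F)
  -- With the order of integration exchanged, almost every translated segment has `F` differentiable
  -- at almost all its points. Translating both endpoints by `y` costs at most `2 L ‖y‖`.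
  have hae : ∀ᵐ y ∂ProbabilityTheory.cond μ (Metric.closedBall (0 : E) η),
      ∀ᵐ t ∂volume.restrict (Set.Icc (0 : ℝ) 1), DifferentiableAt ℝ F (samplePoint x w (t, y)) :=
    (Measure.ae_ae_comm hm).1 (Measure.ae_ae_of_ae_prod (ae_differentiableAt_samplePoint hF hη x w))
  have hint := integrable_inner_gradient_samplePoint (μ := μ) hF hη x w w
  have hmem : ∀ᵐ y ∂ProbabilityTheory.cond μ (Metric.closedBall (0 : E) η), ‖y‖ ≤ η := by
    filter_upwards [ProbabilityTheory.ae_cond_mem (μ := μ)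
      (measurableSet_closedBall (x := (0 : E)) (ε := η))] with y hy
    simpa using hy
  unfold segmentNoise at hint ⊢
  rw [integral_prod_symm _ hint]
  calc _ ≤ ∫ _, (F x - F (x - w) + 2 * L * η)
        ∂ProbabilityTheory.cond μ (Metric.closedBall (0 : E) η) := by
        refine integral_mono_ae hint.integral_prod_right (integrable_const _) ?_
        filter_upwards [hae, hmem] with y hy hyη
        have h := integral_inner_gradient_segment hF (x + y) w hy
        have h1 := hF.dist_le_mul (x + y) x
        have h2 := hF.dist_le_mul (x - w) (x + y - w)
        rw [Real.dist_eq, dist_eq_norm] at h1 h2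
        rw [add_sub_cancel_left] at h1
        rw [show x - w - (x + y - w) = -y by abel, norm_neg] at h2
        have h3 : (L : ℝ) * ‖y‖ ≤ L * η := mul_le_mul_of_nonneg_left hyη L.2
        change ∫ t in Set.Icc (0 : ℝ) 1, inner ℝ (gradient F (x + y - t • w)) w ≤ _
        rw [h]
        linarith [(abs_le.1 h1).2, (abs_le.1 h2).2]
    _ = _ := by simp

/-! ### Goldstein's descent direction -/

lemma exists_differentiableAt_mem_closedBall {F : E → ℝ} {L : ℝ≥0} (hF : LipschitzWith L F)
    {δ : ℝ} (hδ : 0 < δ) (x : E) : ∃ y ∈ Metric.closedBall x δ, DifferentiableAt ℝ F y := by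
  have := isProbabilityMeasure_segmentNoise (Measure.addHaar : Measure E) hδ
  obtain ⟨ω, h1, h2⟩ := ((ae_differentiableAt_samplePoint (μ := Measure.addHaar) hF hδ x 0).and
    (ae_segmentNoise_mem hδ)).exists
  exact ⟨_, samplePoint_mem_closedBall (by simp) h2, h1⟩

omit [MeasurableSpace E] [BorelSpace E] in
lemma gradient_mem_goldsteinSubdifferential {F : E → ℝ} {δ : ℝ} {x y : E}
    (hy : y ∈ Metric.closedBall x δ) (hd : DifferentiableAt ℝ F y) :
    gradient F y ∈ goldsteinSubdifferential F δ x :=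
  subset_convexHull ℝ _ (Set.mem_biUnion hy (subset_convexHull ℝ _
    ⟨fun _ => y, fun _ => hd, tendsto_const_nhds, tendsto_const_nhds⟩))

/-- At a point which is not stationary, some direction makes all nearby gradients large. -/
lemma exists_direction_of_not_isApproxStationary {F : E → ℝ} {L : ℝ≥0} (hF : LipschitzWith L F)
    {δ α : ℝ} (hδ : 0 < δ) (hα : 0 < α) {x : E} (hx : ¬ IsApproxStationary F δ α x) :
    ∃ u : E, ‖u‖ = 1 ∧ ∀ y ∈ Metric.closedBall x δ, DifferentiableAt ℝ F y →
      α ≤ inner ℝ (gradient F y) u := by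
  set G := goldsteinSubdifferential F δ x with hG
  have hconv : Convex ℝ (closure G) := (convex_convexHull ℝ _).closure
  have hne : (closure G).Nonempty := by
    obtain ⟨y, hy, hd⟩ := exists_differentiableAt_mem_closedBall hF hδ x
    exact ⟨_, subset_closure (gradient_mem_goldsteinSubdifferential hy hd)⟩
  -- The variational inequality for the least-norm element reads `⟨g, v⟩ ≥ ‖g‖²` on the whole
  -- closure.
  obtain ⟨g, hg, hmin⟩ := exists_norm_eq_iInf_of_complete_convex hne
    isClosed_closure.isComplete hconv 0
  rw [norm_eq_iInf_iff_real_inner_le_zero hconv hg] at hmin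
  have hgα : α ≤ ‖g‖ := by
    have hsub : closure G ⊆ {v | α ≤ ‖v‖} := by
      refine closure_minimal (fun v hv => ?_) (isClosed_le continuous_const continuous_norm)
      by_contra h
      exact hx ⟨v, hv, (not_le.1 h).le⟩
    exact hsub hg
  have hg0 : 0 < ‖g‖ := hα.trans_le hgα
  refine ⟨‖g‖⁻¹ • g, ?_, fun y hy hd => ?_⟩
  · rw [norm_smul, norm_inv, norm_norm, inv_mul_cancel₀ hg0.ne']
  · have h := hmin _ (subset_closure (gradient_mem_goldsteinSubdifferential hy hd))
    rw [zero_sub, inner_neg_left, inner_sub_right, real_inner_self_eq_norm_sq, real_inner_comm] at h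
    rw [inner_smul_right, inv_mul_eq_div, le_div_iff₀ hg0]
    nlinarith

lemma isApproxStationary_of_lipschitz_le {F : E → ℝ} {L : ℝ≥0} (hF : LipschitzWith L F)
    {δ α : ℝ} (hδ : 0 < δ) (hL : (L : ℝ) ≤ α) (x : E) : IsApproxStationary F δ α x := by
  obtain ⟨y, hy, hd⟩ := exists_differentiableAt_mem_closedBall hF hδ x
  exact ⟨_, gradient_mem_goldsteinSubdifferential hy hd,
    (norm_gradient_le_of_lipschitz hF y).trans hL⟩

/-- A point whose value is close to the infimum is stationary. -/
lemma isApproxStationary_of_gap {F : E → ℝ} {L : ℝ≥0} (hF : LipschitzWith L F)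
    {δ α Δ : ℝ} (hδ : 0 < δ) (hα : 0 < α) (hΔ : Δ < δ / 2 * α) {x : E}
    (hx : ∀ w, F x - F w ≤ Δ) : IsApproxStationary F δ α x := by
  by_contra hns
  obtain ⟨u, hu, hdir⟩ := exists_direction_of_not_isApproxStationary hF hδ hα hns
  -- The noise keeps the samples in the `δ`-ball, and its error `2 L η` stays below the slack `δ / 2
  -- * α - Δ`. A step of length `δ / 2` along `-u` would then decrease `F` by more than `Δ`.
  set η := min (δ / 2) ((δ / 2 * α - Δ) / (4 * (L + 1))) with hη
  have hL0 : (0 : ℝ) ≤ L := L.2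
  have hη0 : 0 < η := lt_min (by linarith) (div_pos (by linarith) (by positivity))
  have hw : ‖(δ / 2) • u‖ = δ / 2 := by
    rw [norm_smul, hu, mul_one, Real.norm_of_nonneg (by linarith)]
  have := isProbabilityMeasure_segmentNoise (Measure.addHaar : Measure E) hη0
  have hle := integral_inner_gradient_samplePoint_le (μ := Measure.addHaar) hF hη0 x ((δ / 2) • u)
  have hge : ∫ _, δ / 2 * α ∂segmentNoise (Measure.addHaar : Measure E) η ≤
      ∫ ω, inner ℝ (gradient F (samplePoint x ((δ / 2) • u) ω)) ((δ / 2) • u)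
        ∂segmentNoise (Measure.addHaar : Measure E) η := by
    refine integral_mono_ae (integrable_const _)
      (integrable_inner_gradient_samplePoint hF hη0 x _ _) ?_
    filter_upwards [ae_differentiableAt_samplePoint hF hη0 x ((δ / 2) • u),
      ae_segmentNoise_mem hη0] with ω h1 h2
    rw [inner_smul_right]
    have hb : ‖(δ / 2) • u‖ + η ≤ δ := by
      rw [hw]
      linarith [min_le_left (δ / 2) ((δ / 2 * α - Δ) / (4 * (L + 1)))]
    exact mul_le_mul_of_nonneg_left (hdir _ (samplePoint_mem_closedBall hb h2) h1) (by linarith)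
  have hηle : η * (4 * (L + 1)) ≤ δ / 2 * α - Δ :=
    (le_div_iff₀ (by positivity)).1 (min_le_right _ _)
  simp only [integral_const, probReal_univ, one_smul] at hge
  nlinarith [hx (x - (δ / 2) • u)]

end Sampling

/-! ### Rounding to a countable dense set -/

section Rounding

variable {E : Type} [NormedAddCommGroup E] [TopologicalSpace.SeparableSpace E]

/-- The first point of a dense sequence at distance less than `r` from `v`. -/
def roundCode (r : ℝ) (v : E) : ℕ := sInf {k | dist v (TopologicalSpace.denseSeq E k) < r}

lemma roundCode_nonempty {r : ℝ} (hr : 0 < r) (v : E) :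
    {k | dist v (TopologicalSpace.denseSeq E k) < r}.Nonempty :=
  (TopologicalSpace.denseRange_denseSeq E).exists_dist_lt v hr

lemma norm_denseSeq_roundCode_sub_lt {r : ℝ} (hr : 0 < r) (v : E) :
    ‖TopologicalSpace.denseSeq E (roundCode r v) - v‖ < r := by
  rw [← dist_eq_norm, dist_comm]
  exact Nat.sInf_mem (roundCode_nonempty hr v)

lemma measurable_roundCode [MeasurableSpace E] [BorelSpace E] {r : ℝ} (hr : 0 < r) :
    Measurable (roundCode r : E → ℕ) := by
  classical
  have h : (roundCode r : E → ℕ) = fun v => Nat.find (roundCode_nonempty hr v) :=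
    funext fun v => Nat.sInf_def _
  rw [h]
  refine measurable_find (p := fun v k => dist v (TopologicalSpace.denseSeq E k) < r) _ fun k => ?_
  exact (isOpen_lt (continuous_id.dist continuous_const) continuous_const).measurableSet

end Rounding

/-! ### A cutting plane method with Steiner points -/

section CuttingPlane

variable {E : Type} [NormedAddCommGroup E] [InnerProductSpace ℝ E]

/-- The directions of the unit ball along which all the vectors of a list are at least `r`. -/
def feasibleDirections (r : ℝ) (S : List E) : Set E :=
  {u ∈ Metric.closedBall (0 : E) 1 | ∀ v ∈ S, r ≤ inner ℝ v u}

lemma feasibleDirections_subset (r : ℝ) (S : List E) :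
    feasibleDirections r S ⊆ Metric.closedBall 0 1 := fun _ h => h.1

lemma feasibleDirections_cons_subset (r : ℝ) (v : E) (S : List E) :
    feasibleDirections r (v :: S) ⊆ feasibleDirections r S :=
  fun _ h => ⟨h.1, fun w hw => h.2 w (List.mem_cons_of_mem v hw)⟩

lemma feasibleDirections_nil_nonempty (r : ℝ) :
    (feasibleDirections r ([] : List E)).Nonempty := ⟨0, by simp [feasibleDirections]⟩

variable [FiniteDimensional ℝ E]

lemma isCompact_feasibleDirections (r : ℝ) (S : List E) :
    IsCompact (feasibleDirections r S) := by
  have h : feasibleDirections r S =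
      Metric.closedBall (0 : E) 1 ∩ ⋂ v ∈ S, {u | r ≤ inner ℝ v u} := by
    ext u
    simp [feasibleDirections]
  rw [h]
  refine (isCompact_closedBall 0 1).inter_right (isClosed_biInter fun v _ => ?_)
  exact isClosed_le continuous_const (continuous_const.inner continuous_id)

variable [MeasurableSpace E] [BorelSpace E]

/-- The displacement tried by the cutting plane method after the gradients `S` have been seen. -/
def trialShift (δ α : ℝ) (S : List E) : E :=
  (δ / 2) • steinerPoint (Measure.addHaar : Measure E) (feasibleDirections (α / 2) S)

open Classical in
/-- One iteration of the cutting plane method, which keeps the current point and a list of rounded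
gradients.  The values at the current point and at the trial point are `a` and `b`; the
rounded gradient at a random point of the segment joining them has code `k`. -/
def cuttingStep (δ α : ℝ) (s : E × List E) (a b : ℝ) (k : ℕ) : E × List E :=
  if feasibleDirections (α / 2) s.2 = ∅ then s
  else if δ / 2 * (α / 8) < a - b then (s.1 - trialShift δ α s.2, [])
  else (s.1, TopologicalSpace.denseSeq E k :: s.2)

/-- The state of the cutting plane method reconstructed from the evaluations, of which there are
three in each iteration. -/
def cuttingState (δ α : ℝ) (x₀ : E) : List (E × ℝ × E) → E × List E
  | c :: b :: a :: l =>
      cuttingStep δ α (cuttingState δ α x₀ l) a.2.1 b.2.1 (roundCode (α / 8) c.2.2)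
  | _ => (x₀, [])

/-- The three points evaluated in an iteration. -/
def cuttingQuery (δ α : ℝ) (s : E × List E) (ω : ℝ × E) : ℕ → E
  | 0 => s.1
  | 1 => s.1 - trialShift δ α s.2
  | _ => samplePoint s.1 (trialShift δ α s.2) ω

/-- The cutting plane method with `J` iterations and perturbations of size `η`. -/
def cuttingPlaneMethod (δ α η : ℝ) (hη : 0 < η) (J : ℕ) : FirstOrderAlgorithm E where
  Seed := Fin J → ℝ × E
  law := Measure.pi fun _ => segmentNoise Measure.addHaar η
  isProbabilityMeasure := by
    have := isProbabilityMeasure_segmentNoise (Measure.addHaar : Measure E) hη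
    infer_instance
  -- The list is latest first, so the drop discards the evaluations of the unfinished iteration; the
  -- remainder of the length tells which of the three points comes next.
  query ω x₀ l := cuttingQuery δ α (cuttingState δ α x₀ (l.drop (l.length % 3)))
    (prolong ω (l.length / 3)) (l.length % 3)
  output _ x₀ l := (cuttingState δ α x₀ l).1

lemma length_history {E : Type} (M : FirstOrderAlgorithm E) (O : E → ℝ × E) (x₀ : E) (ω : M.Seed) (N : ℕ) :
    (M.history O x₀ ω N).length = N := by
  induction N with
  | zero => rfl
  | succ N ih => rw [FirstOrderAlgorithm.history, List.length_cons, ih]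

/-- The code of the gradient seen in an iteration. -/
def gradientCode (δ α : ℝ) (O : E → ℝ × E) (s : E × List E) (ω : ℝ × E) : ℕ :=
  roundCode (α / 8) (O (samplePoint s.1 (trialShift δ α s.2) ω)).2

/-- The transition of the cutting plane method applied to `F`. -/
def cuttingTransition (δ α : ℝ) (F : E → ℝ) (s : E × List E) (k : ℕ) : E × List E :=
  cuttingStep δ α s (F s.1) (F (s.1 - trialShift δ α s.2)) k

/-- Three oracle calls make one step of the random walk. Only values are used from the first two
calls, and these are correct even where `F` is not differentiable. -/
lemma cuttingState_history {δ α : ℝ} {F : E → ℝ} {O : E → ℝ × E} (hO : IsFirstOrderOracle F O)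
    (x₀ : E) (M : FirstOrderAlgorithm E) (ω : M.Seed) (ν : ℕ → ℝ × E)
    (hq : ∀ l : List (E × ℝ × E), M.query ω x₀ l = cuttingQuery δ α
      (cuttingState δ α x₀ (l.drop (l.length % 3))) (ν (l.length / 3)) (l.length % 3)) (j : ℕ) :
    cuttingState δ α x₀ (M.history O x₀ ω (3 * j)) =
      noisyOrbit (fun s ω => cuttingTransition δ α F s (gradientCode δ α O s ω)) ν (x₀, []) j := by
  induction j with
  | zero => rfl
  | succ j ih =>
    have h0 := hq (M.history O x₀ ω (3 * j))
    rw [length_history, Nat.mul_mod_right, Nat.mul_div_cancel_left j (by norm_num),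
      List.drop_zero, ih] at h0
    have h1 := hq (M.history O x₀ ω (3 * j + 1))
    rw [length_history, show (3 * j + 1) % 3 = 1 by omega, show (3 * j + 1) / 3 = j by omega,
      FirstOrderAlgorithm.history, List.drop_succ_cons, List.drop_zero, ih] at h1
    have h2 := hq (M.history O x₀ ω (3 * j + 2))
    rw [length_history, show (3 * j + 2) % 3 = 2 by omega, show (3 * j + 2) / 3 = j by omega,
      FirstOrderAlgorithm.history, FirstOrderAlgorithm.history, List.drop_succ_cons,
      List.drop_succ_cons, List.drop_zero, ih] at h2
    rw [show 3 * (j + 1) = 3 * j + 1 + 1 + 1 by ring, FirstOrderAlgorithm.history,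
      FirstOrderAlgorithm.history, FirstOrderAlgorithm.history, cuttingState, ih, noisyOrbit]
    rw [h0] at h1 h2 ⊢
    rw [h1] at h2 ⊢
    rw [h2]
    simp only [cuttingQuery, (hO _).1]
    rfl

/-! ### Analysis of the cutting plane method -/

/-- The vectors collected are close to gradients at points near the current point. -/
def CutsValid (F : E → ℝ) (δ α : ℝ) (s : E × List E) : Prop :=
  ∀ v ∈ s.2, ∃ y ∈ Metric.closedBall s.1 δ, DifferentiableAt ℝ F y ∧ ‖v - gradient F y‖ ≤ α / 8

/-- At a nonstationary point the direction `u` with slopes at least `α` survives every cut: rounding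
lowers the slopes by at most `α / 8`, and the cuts only demand `α / 2`. -/
lemma isApproxStationary_of_infeasible {F : E → ℝ} {L : ℝ≥0} (hF : LipschitzWith L F)
    {δ α : ℝ} (hδ : 0 < δ) (hα : 0 < α) {s : E × List E} (hs : CutsValid F δ α s)
    (hempty : feasibleDirections (α / 2) s.2 = ∅) : IsApproxStationary F δ α s.1 := by
  by_contra hns
  obtain ⟨u, hu, hdir⟩ := exists_direction_of_not_isApproxStationary hF hδ hα hns
  have hmem : u ∈ feasibleDirections (α / 2) s.2 := by
    refine ⟨by simp [hu], fun v hv => ?_⟩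
    obtain ⟨y, hy, hd, hvy⟩ := hs v hv
    have h1 := hdir y hy hd
    have h2 := (abs_le.1 ((abs_real_inner_le_norm (v - gradient F y) u).trans_eq
      (by rw [hu, mul_one]))).1
    rw [inner_sub_left] at h2
    linarith
  rw [hempty] at hmem
  exact hmem

/-- A bound for the total variation of the normalized mean width. -/
def widthBound (d : ℕ) : ℝ := 2 * 2 ^ (d + 1) + 3

lemma widthBound_pos (d : ℕ) : 0 < widthBound d := by unfold widthBound; positivity

open Classical in
/-- The potential of a set of feasible directions. -/
def widthPotential (K : Set E) : ℝ :=
  if K = ∅ then 0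
  else meanWidth (Measure.addHaar : Measure E) K + 2 ^ (Module.finrank ℝ E + 1) + 3

lemma widthPotential_empty : widthPotential (∅ : Set E) = 0 := if_pos rfl

lemma three_le_widthPotential {K : Set E} (hK : K ⊆ Metric.closedBall 0 1) (hne : K.Nonempty) :
    3 ≤ widthPotential K := by
  rw [widthPotential, if_neg hne.ne_empty]
  linarith [(abs_le.1 (abs_meanWidth_le (μ := Measure.addHaar) hK hne)).1]

lemma widthPotential_le {K : Set E} (hK : K ⊆ Metric.closedBall 0 1) :
    widthPotential K ≤ widthBound (Module.finrank ℝ E) := by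
  rcases K.eq_empty_or_nonempty with rfl | hne
  · rw [widthPotential_empty]; exact (widthBound_pos _).le
  · rw [widthPotential, if_neg hne.ne_empty, widthBound]
    linarith [(abs_le.1 (abs_meanWidth_le (μ := Measure.addHaar) hK hne)).2]

/-- The potential decreases in proportion to the depth of a cut. -/
lemma widthPotential_cons_le {r ℓ : ℝ} (hr : r ≤ ℓ) (hℓ : 0 < ℓ) {S : List E} {v : E}
    (hv : ‖v‖ ≤ 2 * ℓ) (hne : (feasibleDirections r S).Nonempty) :
    1 ≤ widthPotential (feasibleDirections r S) -
        (r - inner ℝ v (steinerPoint Measure.addHaar (feasibleDirections r S))) / (2 * ℓ) ∧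
    widthPotential (feasibleDirections r (v :: S)) ≤ widthPotential (feasibleDirections r S) -
      (r - inner ℝ v (steinerPoint Measure.addHaar (feasibleDirections r S))) / (2 * ℓ) := by
  set K := feasibleDirections r S with hKdef
  have hK : K ⊆ Metric.closedBall 0 1 := feasibleDirections_subset r S
  have h3 := three_le_widthPotential hK hne
  have hdepth : r - inner ℝ v (steinerPoint Measure.addHaar K) ≤ 3 * ℓ := by
    have h1 := norm_steinerPoint_le (μ := (Measure.addHaar : Measure E)) hK
      (isCompact_feasibleDirections r S) hne
    have h2 := abs_real_inner_le_norm v (steinerPoint Measure.addHaar K)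
    have h4 := (abs_le.1 h2).1
    have h5 : ‖v‖ * ‖steinerPoint (Measure.addHaar : Measure E) K‖ ≤ 2 * ℓ * 1 :=
      mul_le_mul hv h1 (norm_nonneg _) (by positivity)
    linarith
  have hfirst : 1 ≤ widthPotential K -
      (r - inner ℝ v (steinerPoint Measure.addHaar K)) / (2 * ℓ) := by
    -- The offset `3` in the potential leaves at least `1` after the largest possible decrease.
    have : (r - inner ℝ v (steinerPoint Measure.addHaar K)) / (2 * ℓ) ≤ 2 := by
      rw [div_le_iff₀ (by positivity)]
      linarith
    linarith
  refine ⟨hfirst, ?_⟩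
  set K' := feasibleDirections r (v :: S) with hK'def
  -- An emptied body has no Steiner point to compare with, but its potential is `0`, and the first
  -- claim suffices.
  rcases K'.eq_empty_or_nonempty with hemp | hne'
  · rw [hemp, widthPotential_empty]
    linarith
  · have hsub : K' ⊆ K := feasibleDirections_cons_subset r v S
    have h1 : r ≤ inner ℝ v (steinerPoint Measure.addHaar K') :=
      le_inner_steinerPoint (hsub.trans hK) (isCompact_feasibleDirections r (v :: S)) hne'
        fun y hy => hy.2 v List.mem_cons_self
    have h2 := inner_steinerPoint_sub_le (μ := (Measure.addHaar : Measure E)) hK hsub hne' v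
    have h3 := meanWidth_mono (μ := (Measure.addHaar : Measure E)) hK hsub hne'
    have h4 : ‖v‖ * (meanWidth (Measure.addHaar : Measure E) K - meanWidth Measure.addHaar K') ≤
        2 * ℓ * (meanWidth Measure.addHaar K - meanWidth Measure.addHaar K') :=
      mul_le_mul_of_nonneg_right hv (sub_nonneg.2 h3)
    have h5 : (r - inner ℝ v (steinerPoint Measure.addHaar K)) / (2 * ℓ) ≤
        meanWidth Measure.addHaar K - meanWidth Measure.addHaar K' := by
      rw [div_le_iff₀ (by positivity)]
      linarith
    rw [widthPotential, widthPotential, if_neg hne'.ne_empty, if_neg hne.ne_empty]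
    linarith

/-- The size of the perturbations used for an `L`-Lipschitz function. -/
def noiseSize (L δ α : ℝ) : ℝ := δ / 2 * α / (16 * L)

lemma norm_trialShift_le {δ α : ℝ} (hδ : 0 < δ) {S : List E}
    (hne : (feasibleDirections (α / 2) S).Nonempty) : ‖trialShift δ α S‖ ≤ δ / 2 := by
  rw [trialShift, norm_smul, Real.norm_of_nonneg (by linarith)]
  exact mul_le_of_le_one_right (by linarith) (norm_steinerPoint_le
    (feasibleDirections_subset _ _) (isCompact_feasibleDirections _ _) hne)

lemma samplePoint_trialShift_mem {L δ α : ℝ} (hδ : 0 < δ) (hα : 0 < α) (hL : α < L) {x : E}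
    {S : List E} (hne : (feasibleDirections (α / 2) S).Nonempty) {ω : ℝ × E}
    (hω : ω.1 ∈ Set.Icc (0 : ℝ) 1 ∧ ‖ω.2‖ ≤ noiseSize L δ α) :
    samplePoint x (trialShift δ α S) ω ∈ Metric.closedBall x δ := by
  refine samplePoint_mem_closedBall ?_ hω
  have h1 := norm_trialShift_le hδ hne
  have h2 : noiseSize L δ α ≤ δ / 2 := by
    rw [noiseSize, div_le_iff₀ (by linarith)]
    exact mul_le_mul_of_nonneg_left (by linarith) (by linarith)
  linarith

/-- The code `c` of the oracle's answer may fail to be measurable; it agrees almost everywhere with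
the code `c'` of the true gradient. -/
lemma tsum_measure_mul_eq_lintegral {Ω : Type*} [MeasurableSpace Ω] {ν : Measure Ω}
    {c c' : Ω → ℕ} (hc' : Measurable c') (h : c =ᵐ[ν] c') (f : ℕ → ENNReal) :
    ∑' k, ν {ω | c ω = k} * f k = ∫⁻ ω, f (c' ω) ∂ν := by
  rw [← lintegral_map (measurable_of_countable f) hc', lintegral_countable']
  congr 1
  funext k
  rw [Measure.map_apply hc' (measurableSet_singleton k), mul_comm]
  congr 1
  refine measure_congr ?_
  filter_upwards [h] with ω hω
  change (c ω = k) = (c' ω = k)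
  rw [hω]

/-- When the trial point does not bring the required decrease, the mean slope of the sampled
gradients in the trial direction is small. -/
lemma integral_inner_gradient_direction_le {F : E → ℝ} {L : ℝ≥0} (hF : LipschitzWith L F)
    {δ α : ℝ} (hδ : 0 < δ) (hα : 0 < α) (hL : α < L) (s : E × List E)
    (hno : F s.1 - F (s.1 - trialShift δ α s.2) ≤ δ / 2 * (α / 8)) :
    ∫ ω, inner ℝ (gradient F (samplePoint s.1 (trialShift δ α s.2) ω))
        (steinerPoint Measure.addHaar (feasibleDirections (α / 2) s.2))
      ∂segmentNoise Measure.addHaar (noiseSize L δ α) ≤ α / 4 := by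
  have hL0 : (0 : ℝ) < L := hα.trans hL
  have hη : 0 < noiseSize L δ α := by unfold noiseSize; positivity
  have h := integral_inner_gradient_samplePoint_le (μ := (Measure.addHaar : Measure E)) hF hη s.1
    (trialShift δ α s.2)
  -- The noise is calibrated so that its error equals the decrease threshold; the two add up to `δ /
  -- 2 * (α / 4)`.
  have hηL : 2 * L * noiseSize L δ α = δ / 2 * (α / 8) := by
    rw [noiseSize]; field_simp; norm_num
  set w := trialShift δ α s.2 with hw
  have hinner : ∀ g : E, inner ℝ g w = δ / 2 * inner ℝ g
      (steinerPoint Measure.addHaar (feasibleDirections (α / 2) s.2)) := fun g => by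
    rw [hw, trialShift, inner_smul_right]
  simp only [hinner] at h
  rw [integral_const_mul] at h
  have hδ2 : 0 < δ / 2 := by linarith
  refine le_of_mul_le_mul_left ?_ hδ2
  linarith

/-- The potential of a state of the cutting plane method; `m` is a lower bound of `F`. -/
def cuttingPotential (F : E → ℝ) (δ α m : ℝ) (s : E × List E) : ℝ :=
  8 * widthBound (Module.finrank ℝ E) / (δ / 2 * α) * (F s.1 - m) +
    widthPotential (feasibleDirections (α / 2) s.2)

/-- The potential decreases in the mean by `α / (16 L)`. -/
lemma cuttingPotential_decrease {F : E → ℝ} {L : ℝ≥0} (hF : LipschitzWith L F)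
    {δ α m : ℝ} (hδ : 0 < δ) (hα : 0 < α) (hL : α < L) (hm : ∀ w, m ≤ F w) {O : E → ℝ × E}
    (hO : IsFirstOrderOracle F O) (s : E × List E)
    (hs : feasibleDirections (α / 2) s.2 ≠ ∅) :
    ENNReal.ofReal (α / (16 * L)) +
      ∑' k, segmentNoise Measure.addHaar (noiseSize L δ α) {ω | gradientCode δ α O s ω = k} *
        ENNReal.ofReal (cuttingPotential F δ α m (cuttingTransition δ α F s k)) ≤
      ENNReal.ofReal (cuttingPotential F δ α m s) := by
  have hL0 : (0 : ℝ) < L := hα.trans hL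
  have hη : 0 < noiseSize L δ α := by unfold noiseSize; positivity
  have := isProbabilityMeasure_segmentNoise (Measure.addHaar : Measure E) hη
  have hne := Set.nonempty_iff_ne_empty.2 hs
  set w := trialShift δ α s.2 with hw
  set c' : ℝ × E → ℕ := fun ω => roundCode (α / 8) (gradient F (samplePoint s.1 w ω)) with hc'
  have hd := ae_differentiableAt_samplePoint (μ := Measure.addHaar) hF hη s.1 w
  have hmeas : Measurable c' := (measurable_roundCode (by linarith)).comp
    ((measurable_gradient F).comp (measurable_samplePoint s.1 w))
  have hcc : gradientCode δ α O s =ᵐ[segmentNoise Measure.addHaar (noiseSize L δ α)] c' := by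
    filter_upwards [hd] with ω hω
    rw [gradientCode, (hO _).2 hω]
  have hw3 := three_le_widthPotential (feasibleDirections_subset (α / 2) s.2) hne
  have hκ : α / (16 * L) ≤ 1 := by
    rw [div_le_one (by positivity)]; linarith
  have hκ0 : 0 ≤ α / (16 * L) := by positivity
  have hB := widthBound_pos (Module.finrank ℝ E)
  set G := 8 * widthBound (Module.finrank ℝ E) / (δ / 2 * α) with hG
  have hG0 : 0 < G := by positivity
  have hval : ∀ w, 0 ≤ G * (F w - m) := fun w => mul_nonneg hG0.le (sub_nonneg.2 (hm w))
  rw [tsum_measure_mul_eq_lintegral hmeas hcc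
    (fun k => ENNReal.ofReal (cuttingPotential F δ α m (cuttingTransition δ α F s k)))]
  by_cases hdesc : δ / 2 * (α / 8) < F s.1 - F (s.1 - w)
  · have htr : ∀ k, cuttingTransition δ α F s k = (s.1 - w, []) := fun k => by
      rw [cuttingTransition, cuttingStep, if_neg hs, if_pos hdesc]
    simp only [htr, lintegral_const, measure_univ, mul_one]
    have hlen := widthPotential_le (feasibleDirections_subset (α / 2) ([] : List E))
    -- The weight `G` makes the least accepted decrease of `F` pay for a full reset of the width
    -- potential.
    have hgain : widthBound (Module.finrank ℝ E) ≤ G * (F s.1 - F (s.1 - w)) := by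
      calc widthBound (Module.finrank ℝ E) = G * (δ / 2 * (α / 8)) := by
            rw [hG]; field_simp
        _ ≤ _ := mul_le_mul_of_nonneg_left hdesc.le hG0.le
    have h0 : 0 ≤ cuttingPotential F δ α m (s.1 - w, []) :=
      add_nonneg (hval _) (zero_le_three.trans (three_le_widthPotential
        (feasibleDirections_subset _ _) (feasibleDirections_nil_nonempty _)))
    rw [← ENNReal.ofReal_add hκ0 h0]
    refine ENNReal.ofReal_le_ofReal ?_
    simp only [cuttingPotential, ← hG]
    linarith
  · have htr : ∀ k, cuttingTransition δ α F s k =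
        (s.1, TopologicalSpace.denseSeq E k :: s.2) := fun k => by
      rw [cuttingTransition, cuttingStep, if_neg hs, if_neg hdesc]
    set u := steinerPoint Measure.addHaar (feasibleDirections (α / 2) s.2) with hu
    have hu1 : ‖u‖ ≤ 1 := norm_steinerPoint_le (feasibleDirections_subset _ _)
      (isCompact_feasibleDirections _ _) hne
    set P := cuttingPotential F δ α m s with hP
    -- A bound for the next potential in terms of the exact gradient, the `α / 8` accounting for
    -- rounding. As the mean slope is at most `α / 4`, its mean is at most `P - (α / 8) / (2 * L)`.
    set h : ℝ × E → ℝ := fun ω =>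
      P - (α / 2 - α / 8 - inner ℝ (gradient F (samplePoint s.1 w ω)) u) / (2 * L) with hh
    have hkey : ∀ ω, 0 ≤ h ω ∧
        cuttingPotential F δ α m (cuttingTransition δ α F s (c' ω)) ≤ h ω := by
      intro ω
      set g := gradient F (samplePoint s.1 w ω) with hg
      set v := TopologicalSpace.denseSeq E (c' ω) with hv
      have hvg : ‖v - g‖ < α / 8 := norm_denseSeq_roundCode_sub_lt (by linarith) g
      have hgL : ‖g‖ ≤ L := norm_gradient_le_of_lipschitz hF _
      have hv2 : ‖v‖ ≤ 2 * L := by linarith [norm_le_norm_add_norm_sub' v g]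
      obtain ⟨h1, h2⟩ := widthPotential_cons_le (r := α / 2) (by linarith) hL0 hv2 hne
      have hin : inner ℝ v u ≤ inner ℝ g u + α / 8 := by
        have h3 := real_inner_le_norm (v - g) u
        have h4 : ‖v - g‖ * ‖u‖ ≤ α / 8 * 1 :=
          mul_le_mul hvg.le hu1 (norm_nonneg _) (by linarith)
        rw [inner_sub_left] at h3
        linarith
      have hcmp : (α / 2 - α / 8 - inner ℝ g u) / (2 * L) ≤ (α / 2 - inner ℝ v u) / (2 * L) :=
        div_le_div_of_nonneg_right (by linarith) (by positivity)
      rw [htr]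
      simp only [hh, hP, cuttingPotential, ← hG]
      have := hval s.1
      constructor <;> linarith
    have hinner := integrable_inner_gradient_samplePoint (μ := Measure.addHaar) hF hη s.1 w u
    have hint : Integrable h (segmentNoise Measure.addHaar (noiseSize L δ α)) :=
      (integrable_const P).sub (((integrable_const (α / 2 - α / 8)).sub hinner).div_const _)
    have hI : ∫ ω, h ω ∂segmentNoise Measure.addHaar (noiseSize L δ α) ≤ P - α / (16 * L) := by
      have hmean := integral_inner_gradient_direction_le hF hδ hα hL s (not_lt.1 hdesc)
      have heq : ∫ ω, h ω ∂segmentNoise Measure.addHaar (noiseSize L δ α) =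
          P - (α / 2 - α / 8 - ∫ ω, inner ℝ (gradient F (samplePoint s.1 w ω)) u
            ∂segmentNoise Measure.addHaar (noiseSize L δ α)) / (2 * L) := by
        have h1 := integral_sub (integrable_const P)
          (((integrable_const (α / 2 - α / 8)).sub hinner).div_const (2 * (L : ℝ)))
        have h2 := integral_sub (integrable_const (α / 2 - α / 8)) hinner
        simp only [Pi.sub_apply, integral_const, probReal_univ, one_smul] at h1 h2
        rw [integral_div, h2] at h1
        exact h1
      rw [heq]
      have : α / (16 * L) = (α / 8) / (2 * L) := by field_simp; norm_num
      rw [this]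
      refine sub_le_sub_left (div_le_div_of_nonneg_right ?_ (by positivity)) P
      linarith
    calc _ ≤ ENNReal.ofReal (α / (16 * L)) + ∫⁻ ω, ENNReal.ofReal (h ω)
          ∂segmentNoise Measure.addHaar (noiseSize L δ α) := by
          refine add_le_add le_rfl (lintegral_mono fun ω => ENNReal.ofReal_le_ofReal (hkey ω).2)
      _ = ENNReal.ofReal (α / (16 * L)) + ENNReal.ofReal
          (∫ ω, h ω ∂segmentNoise Measure.addHaar (noiseSize L δ α)) := by
          rw [ofReal_integral_eq_lintegral_ofReal hint
            (Eventually.of_forall fun ω => (hkey ω).1)]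
      _ ≤ ENNReal.ofReal P := by
          rw [← ENNReal.ofReal_add hκ0 (integral_nonneg fun ω => (hkey ω).1)]
          exact ENNReal.ofReal_le_ofReal (by linarith)

/-- A code of positive outer probability is produced by some noise for which `F` is differentiable
at the sample and the sample lies in the `δ`-ball. Arbitrary oracle answers account only for codes
of measure zero. -/
lemma CutsValid.transition {F : E → ℝ} {L : ℝ≥0} (hF : LipschitzWith L F)
    {δ α : ℝ} (hδ : 0 < δ) (hα : 0 < α) (hL : α < L) {O : E → ℝ × E}
    (hO : IsFirstOrderOracle F O) {s : E × List E} (hv : CutsValid F δ α s)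
    (hs : feasibleDirections (α / 2) s.2 ≠ ∅) {k : ℕ}
    (hk : segmentNoise Measure.addHaar (noiseSize L δ α) {ω | gradientCode δ α O s ω = k} ≠ 0) :
    CutsValid F δ α (cuttingTransition δ α F s k) := by
  have hL0 : (0 : ℝ) < L := hα.trans hL
  have hη : 0 < noiseSize L δ α := by unfold noiseSize; positivity
  rw [cuttingTransition, cuttingStep, if_neg hs]
  split_ifs with hdesc
  · exact fun v hv => absurd hv List.not_mem_nil
  · intro v hvm
    rcases List.mem_cons.1 hvm with rfl | hvm
    · have hfreq : ∃ᵐ ω ∂segmentNoise Measure.addHaar (noiseSize L δ α),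
          gradientCode δ α O s ω = k := frequently_ae_iff.2 hk
      obtain ⟨ω, hω, hd, hmem⟩ := (hfreq.and_eventually
        ((ae_differentiableAt_samplePoint hF hη s.1 (trialShift δ α s.2)).and
          (ae_segmentNoise_mem hη))).exists
      refine ⟨_, samplePoint_trialShift_mem hδ hα hL (Set.nonempty_iff_ne_empty.2 hs) hmem, hd, ?_⟩
      rw [← hω, gradientCode, (hO _).2 hd]
      exact (norm_denseSeq_roundCode_sub_lt (by linarith) _).le
    · exact hv v hvm

/-- The cutting plane method finds a stationary point with high probability. -/
theorem cuttingPlaneMethod_findsStationary {F : E → ℝ} {L : ℝ≥0} (hF : LipschitzWith L F)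
    {δ α Δ p : ℝ} (hδ : 0 < δ) (hα : 0 < α) (hL : α < L)
    (hη : 0 < noiseSize L δ α) (x₀ : E) (hx₀ : ∀ w, F x₀ - F w ≤ Δ) {J : ℕ}
    (hJ : widthBound (Module.finrank ℝ E) * (16 * Δ / (δ * α) + 1) ≤ J * (α / (16 * L)) * p) :
    (cuttingPlaneMethod δ α (noiseSize L δ α) hη J).FindsStationary F δ α p x₀ (3 * J) := by
  intro O hO
  have hL0 : (0 : ℝ) < L := hα.trans hL
  have := isProbabilityMeasure_segmentNoise (Measure.addHaar : Measure E) hη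
  have hbound := absorption_bound (segmentNoise (Measure.addHaar : Measure E) (noiseSize L δ α))
    (gradientCode δ α O) (cuttingTransition δ α F) (CutsValid F δ α)
    (fun s => feasibleDirections (α / 2) s.2 = ∅)
    (fun s => ENNReal.ofReal (cuttingPotential F δ α (F x₀ - Δ) s)) (ENNReal.ofReal (α / (16 * L)))
    (fun s hs k => by rw [cuttingTransition, cuttingStep, if_pos hs])
    (fun s hv hs k hk => hv.transition hF hδ hα hL hO hs hk)
    (fun s _ hs => cuttingPotential_decrease hF hδ hα hL (fun w => by linarith [hx₀ w]) hO s hs)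
    J (x₀, []) (fun v hv => absurd hv List.not_mem_nil)
  have hΨ : ENNReal.ofReal (cuttingPotential F δ α (F x₀ - Δ) (x₀, [])) ≤
      J * ENNReal.ofReal (α / (16 * L)) * ENNReal.ofReal p := by
    rw [← ENNReal.ofReal_natCast, ← ENNReal.ofReal_mul (by positivity),
      ← ENNReal.ofReal_mul (by positivity)]
    refine ENNReal.ofReal_le_ofReal (le_trans ?_ hJ)
    have h1 := widthPotential_le (feasibleDirections_subset (α / 2) ([] : List E))
    rw [cuttingPotential, sub_sub_cancel]
    have h2 : 8 * widthBound (Module.finrank ℝ E) / (δ / 2 * α) * Δ =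
        widthBound (Module.finrank ℝ E) * (16 * Δ / (δ * α)) := by
      field_simp; ring
    rw [h2]
    linarith
  have hJ0 : (J : ENNReal) * ENNReal.ofReal (α / (16 * L)) ≠ 0 := by
    have hΔ : 0 ≤ Δ := by simpa using hx₀ x₀
    have hpos : 0 < widthBound (Module.finrank ℝ E) * (16 * Δ / (δ * α) + 1) :=
      mul_pos (widthBound_pos _) (by positivity)
    have hJne : J ≠ 0 := by
      rintro rfl
      norm_num at hJ
      linarith
    refine mul_ne_zero (by exact_mod_cast hJne) ?_
    simpa using (by positivity : 0 < α / (16 * L))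
  have hJtop : (J : ENNReal) * ENNReal.ofReal (α / (16 * L)) ≠ ⊤ :=
    ENNReal.mul_ne_top (ENNReal.natCast_ne_top J) ENNReal.ofReal_ne_top
  have hprob := (ENNReal.mul_le_mul_iff_right hJ0 hJtop).1 (hbound.trans hΨ)
  refine le_trans (measure_mono fun ω hω => ?_) hprob
  refine fun hgood => hω ?_
  have hst := isApproxStationary_of_infeasible hF hδ hα hgood.1 hgood.2
  rwa [← cuttingState_history hO x₀ (cuttingPlaneMethod δ α (noiseSize L δ α) hη J) ω (prolong ω)
    fun _ => rfl] at hst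

/-! ### Evaluation complexity for Lipschitz functions -/

/-- The algorithm that returns its starting point. -/
def idleAlgorithm (E : Type) : FirstOrderAlgorithm E where
  Seed := Unit
  law := Measure.dirac ()
  query _ x₀ _ := x₀
  output _ x₀ _ := x₀

omit [FiniteDimensional ℝ E] [MeasurableSpace E] [BorelSpace E] in
lemma idleAlgorithm_findsStationary [CompleteSpace E] {F : E → ℝ} {δ α p : ℝ} {x₀ : E}
    (h : IsApproxStationary F δ α x₀) : (idleAlgorithm E).FindsStationary F δ α p x₀ 0 := by
  intro O _
  have hset : {ω | ¬ IsApproxStationary F δ α ((idleAlgorithm E).answer O x₀ 0 ω)} = ∅ :=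
    Set.eq_empty_of_forall_notMem fun _ hω => hω h
  rw [hset, measure_empty]
  exact zero_le

/-- The constant of the convergence rate. -/
def rateConstant (d : ℕ) (p : ℝ) : ℝ := 3072 * widthBound d / p

/-- Lipschitz functions on a `d`-dimensional space can be made stationary with
`O(L Δ / (δ α²))` evaluations. -/
theorem exists_firstOrderAlgorithm (L : ℝ≥0) {Δ δ p α : ℝ} (hΔ : 0 ≤ Δ) (hδ : 0 < δ) (hp : 0 < p)
    (hp1 : p < 1) (hα : 0 < α) :
    ∃ (N : ℕ) (M : FirstOrderAlgorithm E),
      (N : ℝ) ≤ rateConstant (Module.finrank ℝ E) p * (L * Δ / (δ * α ^ 2)) ∧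
      ∀ F : E → ℝ, LipschitzWith L F → ∀ x₀, (∀ w, F x₀ - F w ≤ Δ) →
        M.FindsStationary F δ α p x₀ N := by
  have hB := widthBound_pos (Module.finrank ℝ E)
  have hL0 : (0 : ℝ) ≤ L := L.2
  -- In either of these cases the starting point is already stationary. Otherwise `L / α` and `16 *
  -- Δ / (δ * α)` are at least `1`, which absorbs the additive `1` in the potential and the rounding
  -- up of the number of iterations.
  by_cases htriv : (L : ℝ) ≤ α ∨ Δ < δ * α / 16
  · refine ⟨0, idleAlgorithm E, ?_, fun F hF x₀ hx₀ => idleAlgorithm_findsStationary ?_⟩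
    · rw [rateConstant, Nat.cast_zero]; positivity
    · rcases htriv with h | h
      · exact isApproxStationary_of_lipschitz_le hF hδ h x₀
      · refine isApproxStationary_of_gap hF hδ hα ?_ hx₀
        have : 0 < δ * α := by positivity
        linarith
  · push Not at htriv
    obtain ⟨hL, hΔl⟩ := htriv
    have hLp : (0 : ℝ) < L := hα.trans hL
    have hη : 0 < noiseSize L δ α := by unfold noiseSize; positivity
    set B := widthBound (Module.finrank ℝ E) with hBdef
    -- Here `512 = 32 * 16`: the initial potential is at most `32 * B * Δ / (δ * α)`, and each
    -- iteration gains `α / (16 * L)`.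
    set X : ℝ := 512 * B / p * (L * Δ / (δ * α ^ 2)) with hX
    have hratio : 1 / 16 ≤ Δ / (δ * α) := by
      rw [le_div_iff₀ (by positivity)]; linarith
    have hX1 : 1 ≤ X := by
      have h1 : 1 ≤ B := by
        rw [hBdef, widthBound]
        have : (0 : ℝ) ≤ 2 * 2 ^ (Module.finrank ℝ E + 1) := by positivity
        linarith
      have h2 : 1 ≤ B / p := by rw [le_div_iff₀ hp]; linarith
      have h3 : 1 ≤ L / α := by rw [le_div_iff₀ hα]; linarith
      calc (1 : ℝ) ≤ 512 * 1 * (1 * (1 / 16)) := by norm_num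
        _ ≤ 512 * (B / p) * (L / α * (Δ / (δ * α))) := by gcongr
        _ = X := by rw [hX]; field_simp
    refine ⟨3 * ⌈X⌉₊, cuttingPlaneMethod δ α _ hη ⌈X⌉₊, ?_, fun F hF x₀ hx₀ =>
      cuttingPlaneMethod_findsStationary hF hδ hα hL hη x₀ hx₀ ?_⟩
    · have hceil := (Nat.ceil_lt_add_one (zero_le_one.trans hX1)).le
      push_cast
      -- As `X ≥ 1`, rounding up at most doubles it; this is the origin of `3072 = 6 * 512`.
      calc (3 : ℝ) * ⌈X⌉₊ ≤ 6 * X := by linarith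
        _ = _ := by rw [hX, rateConstant]; ring
    · calc B * (16 * Δ / (δ * α) + 1) ≤ B * (32 * (Δ / (δ * α))) := by
            refine mul_le_mul_of_nonneg_left ?_ hB.le
            rw [mul_div_assoc]
            linarith
        _ = X * (α / (16 * L)) * p := by rw [hX]; field_simp; ring
        _ ≤ _ := by
            gcongr
            exact Nat.le_ceil X

end CuttingPlane

/-! ### Lipschitz bounds for networks -/

lemma norm_mulVec_le_matNorm {a b : ℕ} (A : Matrix (Fin a) (Fin b) ℝ) (v : Fin b → ℝ) :
    ‖A *ᵥ v‖ ≤ matNorm A * ‖v‖ :=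
  Matrix.linfty_opNorm_mulVec A v

/-- Each of the `b` entries of a row is at most the Euclidean norm of `w`. This comparison of norms
brings the width into the Lipschitz constant. -/
lemma norm_of_mulVec_le {a b : ℕ} (w : EuclideanSpace ℝ (Fin a × Fin b)) (v : Fin b → ℝ) :
    ‖(Matrix.of fun i j => w (i, j)) *ᵥ v‖ ≤ b * ‖w‖ * ‖v‖ := by
  refine (pi_norm_le_iff_of_nonneg (by positivity)).2 fun i => ?_
  calc ‖∑ j, w (i, j) * v j‖ ≤ ∑ _j : Fin b, ‖w‖ * ‖v‖ := by
        refine norm_sum_le_of_le _ fun j _ => ?_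
        rw [norm_mul]
        exact mul_le_mul (PiLp.norm_apply_le w (i, j)) (norm_le_pi_norm v j) (norm_nonneg _)
          (norm_nonneg _)
    _ = b * ‖w‖ * ‖v‖ := by simp [mul_assoc]

variable {n : ℕ → ℕ}

/-- Normalization is absorbed into the activations, so that one Lipschitz estimate serves both kinds
of network. -/
lemma normalizedDnn_eq_dnn (g NO : LayerMaps n) (W : Weights n) (x : Fin (n 0) → ℝ) (k : ℕ) :
    normalizedDnn g NO W x k = dnn (fun k => g k ∘ NO k) W x k := by
  induction k with
  | zero => rfl
  | succ k ih => rw [normalizedDnn, dnn, ih]; rfl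

lemma setLayer_self (W : Weights n) (i : ℕ) (w : LayerSpace n i) :
    setLayer W i w i = Matrix.of fun a b => w (a, b) := Function.update_self ..

lemma setLayer_of_ne (W : Weights n) {i k : ℕ} (h : k ≠ i) (w : LayerSpace n i) :
    setLayer W i w k = W k := Function.update_of_ne h ..

lemma dnn_setLayer_of_lt (g : LayerMaps n) (W : Weights n) (i : ℕ) (w : LayerSpace n i)
    (x : Fin (n 0) → ℝ) {k : ℕ} (hk : k < i) : dnn g (setLayer W i w) x k = dnn g W x k := by
  induction k with
  | zero => rfl
  | succ k ih => rw [dnn, dnn, ih (by omega), setLayer_of_ne W (by omega)]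

/-- The dependence of the signals of the later layers on the weights of layer `i`. -/
lemma norm_dnn_setLayer_sub_le {K : ℕ} {g : LayerMaps n} {ρ : ℝ≥0}
    (hg : ∀ k, 1 ≤ k → k ≤ K → LipschitzWith ρ (g k)) {s : ℕ → ℝ} {W : Weights n}
    (hW : InFamily K s W) {i : ℕ} (hi : 1 ≤ i) {A : ℝ} {x : Fin (n 0) → ℝ}
    (hA : ‖dnn g W x (i - 1)‖ ≤ A) (hs : ∀ k, 1 ≤ k → k ≤ K → 0 ≤ s k)
    (w w' : LayerSpace n i) {k : ℕ} (hik : i ≤ k) (hk : k ≤ K) :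
    ‖dnn g (setLayer W i w) x k - dnn g (setLayer W i w') x k‖ ≤
      ρ ^ (k + 1 - i) * (∏ j ∈ Finset.Ioc i k, s j) * (n (i - 1) * A * ‖w - w'‖) := by
  -- The input of layer `i` does not depend on its weights. Layer `i` itself contributes a factor
  -- `ρ` but no `s i`; each later layer contributes both.
  induction k, hik using Nat.le_induction with
  | base =>
    obtain ⟨j, rfl⟩ : ∃ j, i = j + 1 := ⟨i - 1, by omega⟩
    rw [dnn, dnn, dnn_setLayer_of_lt g W _ w x (Nat.lt_succ_self j),
      dnn_setLayer_of_lt g W _ w' x (Nat.lt_succ_self j), setLayer_self, setLayer_self]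
    refine ((hg (j + 1) hi hk).norm_sub_le _ _).trans ?_
    have h1 := norm_of_mulVec_le (w - w') (dnn g W x j)
    have h2 : (Matrix.of fun a b => (w - w') (a, b)) =
        (Matrix.of fun a b => w (a, b)) - Matrix.of fun a b => w' (a, b) := rfl
    rw [h2, Matrix.sub_mulVec] at h1
    have h3 : (n j : ℝ) * ‖w - w'‖ * ‖dnn g W x j‖ ≤ n j * ‖w - w'‖ * A :=
      mul_le_mul_of_nonneg_left hA (by positivity)
    simp only [Nat.add_sub_cancel_left, pow_one, Finset.Ioc_self, Finset.prod_empty, mul_one]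
    refine mul_le_mul_of_nonneg_left ((h1.trans h3).trans_eq ?_) ρ.2
    change (n j : ℝ) * ‖w - w'‖ * A = n j * A * ‖w - w'‖
    ring
  | succ k hik ih =>
    rw [dnn, dnn, setLayer_of_ne W (by omega), setLayer_of_ne W (by omega)]
    refine ((hg (k + 1) (by omega) hk).norm_sub_le _ _).trans ?_
    rw [← Matrix.mulVec_sub]
    have h1 := norm_mulVec_le_matNorm (W (k + 1))
      (dnn g (setLayer W i w) x k - dnn g (setLayer W i w') x k)
    have h2 := mul_le_mul (hW (k + 1) (by omega) hk) (ih (by omega)) (norm_nonneg _)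
      (hs (k + 1) (by omega) hk)
    refine (mul_le_mul_of_nonneg_left (h1.trans h2) ρ.2).trans_eq ?_
    rw [Finset.prod_Ioc_succ_top hik, show k + 1 + 1 - i = k + 1 - i + 1 by omega, pow_succ]
    change (ρ : ℝ) * _ = _
    ring

lemma abs_empiricalLoss_sub_le {a b m : ℕ} (hm : 0 < m) {f : (Fin b → ℝ) → (Fin a → ℝ) → ℝ}
    {Lf : ℝ≥0} (hf : ∀ x, LipschitzWith Lf fun v => f v x) (D : Fin m → (Fin a → ℝ))
    {h h' : (Fin a → ℝ) → (Fin b → ℝ)} {r : ℝ} (hr : ∀ t, ‖h (D t) - h' (D t)‖ ≤ r) :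
    |empiricalLoss f D h - empiricalLoss f D h'| ≤ Lf * r := by
  have hm' : (0 : ℝ) < m := by exact_mod_cast hm
  rw [empiricalLoss, empiricalLoss, ← mul_sub, ← Finset.sum_sub_distrib, abs_mul,
    abs_of_pos (by positivity), one_div, inv_mul_le_iff₀ hm']
  calc |∑ t, (f (h (D t)) (D t) - f (h' (D t)) (D t))| ≤ ∑ _t : Fin m, Lf * r := by
        refine (Finset.abs_sum_le_sum_abs _ _).trans (Finset.sum_le_sum fun t _ => ?_)
        exact ((hf (D t)).norm_sub_le _ _).trans (mul_le_mul_of_nonneg_left (hr t) Lf.2)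
    _ = m * (Lf * r) := by simp

lemma lipschitzWith_batchNorm {d : ℕ} (B : BNStats d) {ε σ : ℝ} (hσ : 0 < σ)
    (h : ∀ j, σ ≤ √(B.var j + ε)) : LipschitzWith (Real.toNNReal σ⁻¹) (batchNorm B ε) := by
  refine LipschitzWith.of_dist_le_mul fun y y' => ?_
  rw [Real.coe_toNNReal _ (by positivity)]
  refine (dist_pi_le_iff (by positivity)).2 fun j => ?_
  rw [Real.dist_eq, batchNorm, batchNorm, ← sub_div, sub_sub_sub_cancel_right, abs_div,
    abs_of_pos (hσ.trans_le (h j)), div_eq_inv_mul, ← Real.dist_eq]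
  exact mul_le_mul (inv_anti₀ hσ (h j)) (dist_le_pi_dist y y' j) dist_nonneg (by positivity)

/-- The Lipschitz constant of the empirical loss in the weights of layer `i`. -/
def lossLipschitzConstant (K : ℕ) (n : ℕ → ℕ) (i : ℕ) (s : ℕ → ℝ) (Lf ρ : ℝ≥0) (A : ℝ) : ℝ≥0 :=
  Lf * ρ ^ (K + 1 - i) * Real.toNNReal ((∏ k ∈ Finset.Ioc i K, s k) * (n i * n (i - 1) * A))

lemma coe_lossLipschitzConstant {K i : ℕ} {s : ℕ → ℝ} (hs : ∀ k, 1 ≤ k → k ≤ K → 0 ≤ s k)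
    (Lf ρ : ℝ≥0) {A : ℝ} (hA : 0 ≤ A) : (lossLipschitzConstant K n i s Lf ρ A : ℝ) =
      Lf * ρ ^ (K + 1 - i) * ((∏ k ∈ Finset.Ioc i K, s k) * (n i * n (i - 1) * A)) := by
  have hprod : 0 ≤ ∏ k ∈ Finset.Ioc i K, s k := Finset.prod_nonneg fun k hk => by
    rw [Finset.mem_Ioc] at hk
    exact hs k (by omega) hk.2
  rw [lossLipschitzConstant, NNReal.coe_mul, NNReal.coe_mul, NNReal.coe_pow,
    Real.coe_toNNReal _ (by positivity)]

lemma lipschitzWith_lossDnn {K i m : ℕ} (hi : 1 ≤ i) (hiK : i < K) (hni : 0 < n i)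
    {s : ℕ → ℝ} (hs : ∀ k, 1 ≤ k → k ≤ K → 0 ≤ s k) {Lf ρ : ℝ≥0} {A : ℝ} (hA : 0 ≤ A)
    {g : LayerMaps n} (hg : ∀ k, 1 ≤ k → k ≤ K → LipschitzWith ρ (g k)) {W : Weights n}
    (hW : InFamily K s W) (hm : 0 < m) {D : Fin m → (Fin (n 0) → ℝ)}
    {f : (Fin (n K) → ℝ) → (Fin (n 0) → ℝ) → ℝ} (hf : ∀ x, LipschitzWith Lf fun v => f v x)
    (hD : ∀ t, ‖dnn g W (D t) (i - 1)‖ ≤ A) :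
    LipschitzWith (lossLipschitzConstant K n i s Lf ρ A) (lossDnn K f D g W i) := by
  refine LipschitzWith.of_dist_le_mul fun w w' => ?_
  rw [coe_lossLipschitzConstant hs Lf ρ hA, Real.dist_eq, dist_eq_norm]
  have hprod : 0 ≤ ∏ k ∈ Finset.Ioc i K, s k := Finset.prod_nonneg fun k hk => by
    rw [Finset.mem_Ioc] at hk
    exact hs k (by omega) hk.2
  -- The width `n i` is inserted only so that the constant involves the widths through the product
  -- `n i * n (i - 1)`, which is the dimension.
  have hni' : (1 : ℝ) ≤ n i := by exact_mod_cast hni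
  refine (abs_empiricalLoss_sub_le hm hf D fun t =>
    norm_dnn_setLayer_sub_le hg hW hi (hD t) hs w w' hiK.le le_rfl).trans ?_
  calc _ = Lf * (ρ ^ (K + 1 - i) * ((∏ k ∈ Finset.Ioc i K, s k) *
        (1 * n (i - 1) * A))) * ‖w - w'‖ := by ring
    _ ≤ Lf * (ρ ^ (K + 1 - i) * ((∏ k ∈ Finset.Ioc i K, s k) *
        (n i * n (i - 1) * A))) * ‖w - w'‖ := by gcongr
    _ = _ := by ring

lemma lossBN_eq_lossDnn {K i m : ℕ} (f : (Fin (n K) → ℝ) → (Fin (n 0) → ℝ) → ℝ)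
    (D : Fin m → (Fin (n 0) → ℝ)) (g : LayerMaps n) (B : (k : ℕ) → BNStats (n k)) (ε : ℝ)
    (W : Weights n) :
    lossBN K f D g B ε W i = lossDnn K f D (fun k => g k ∘ batchNorm (B k) ε) W i := by
  funext w
  simp only [lossBN, lossDnn, normalizedDnn_eq_dnn]

lemma finrank_layerSpace (i : ℕ) : Module.finrank ℝ (LayerSpace n i) = n i * n (i - 1) := by
  simp

end

/-! ### Convergence rates for plain and batch-normalized networks -/

theorem mainTheorem12 :
    -- the constant depends only on the number of weights of layer `i` and the failure probability
    ∃ C : ℕ → ℝ → ℝ,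
      ∀ (K : ℕ) (n : ℕ → ℕ) (_ : ∀ k, k ≤ K → 0 < n k)
        (i : ℕ) (_ : 1 ≤ i) (_ : i < K)
        (s : ℕ → ℝ) (_ : ∀ k, 1 ≤ k → k ≤ K → 0 ≤ s k)
        (Lf : ℝ≥0) (A Δ δ p α : ℝ) (_ : 0 ≤ A) (_ : 0 ≤ Δ) (_ : 0 < δ)
        (_ : 0 < p) (_ : p < 1) (_ : 0 < α),
        -- unnormalized networks
        (∃ (N : ℕ) (M : FirstOrderAlgorithm (LayerSpace n i)),
          (N : ℝ) ≤ C (n i * n (i - 1)) p * (Lf * A * Δ / δ) *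
            ((∏ k ∈ Finset.Ioc i K, s k) / α ^ 2) ∧
          ∀ (g : LayerMaps n) (_ : ∀ k, 1 ≤ k → k ≤ K → LipschitzWith 1 (g k))
            (W : Weights n) (_ : InFamily K s W)
            (m : ℕ) (_ : 0 < m) (D : Fin m → (Fin (n 0) → ℝ))
            (f : (Fin (n K) → ℝ) → (Fin (n 0) → ℝ) → ℝ)
            (_ : ∀ x, LipschitzWith Lf (fun v => f v x))
            (_ : ∀ t, ‖dnn g W (D t) (i - 1)‖ ≤ A)
            (w₀ : LayerSpace n i)
            (_ : ∀ w, lossDnn K f D g W i w₀ - lossDnn K f D g W i w ≤ Δ),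
            M.FindsStationary (lossDnn K f D g W i) δ α p w₀ N) ∧
        -- networks with batch normalization
        (∀ σ : ℝ, 0 < σ →
          ∃ (N : ℕ) (M : FirstOrderAlgorithm (LayerSpace n i)),
          (N : ℝ) ≤ C (n i * n (i - 1)) p * (Lf * A * Δ / δ) *
            (σ ^ (-(K : ℤ) + (i : ℤ) - 1) * (∏ k ∈ Finset.Ioc i K, s k) / α ^ 2) ∧
          ∀ (ε : ℝ) (_ : 0 < ε) (B : (k : ℕ) → BNStats (n k)) (_ : IsLeastDeviation K B ε σ)
            (g : LayerMaps n) (_ : ∀ k, 1 ≤ k → k ≤ K → LipschitzWith 1 (g k))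
            (W : Weights n) (_ : InFamily K s W)
            (m : ℕ) (_ : 0 < m) (D : Fin m → (Fin (n 0) → ℝ))
            (f : (Fin (n K) → ℝ) → (Fin (n 0) → ℝ) → ℝ)
            (_ : ∀ x, LipschitzWith Lf (fun v => f v x))
            (_ : ∀ t, ‖normalizedDnn g (fun k => batchNorm (B k) ε) W (D t) (i - 1)‖ ≤ A)
            (w₀ : LayerSpace n i)
            (_ : ∀ w, lossBN K f D g B ε W i w₀ - lossBN K f D g B ε W i w ≤ Δ),
            M.FindsStationary (lossBN K f D g B ε W i) δ α p w₀ N) := by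
  -- The extra factor `d` is the `n i * n (i - 1)` of the Lipschitz constant of the loss.
  refine ⟨fun d p => d * rateConstant d p, ?_⟩
  intro K n hn i hi hiK s hs Lf A Δ δ p α hA hΔ hδ hp hp1 hα
  refine ⟨?_, fun σ hσ => ?_⟩
  · obtain ⟨N, M, hN, hM⟩ := exists_firstOrderAlgorithm (E := LayerSpace n i)
      (lossLipschitzConstant K n i s Lf 1 A) hΔ hδ hp hp1 hα
    refine ⟨N, M, hN.trans_eq ?_, fun g hg W hW m hm D f hf hD w₀ hw₀ =>
      hM _ (lipschitzWith_lossDnn hi hiK (hn i hiK.le) hs hA hg hW hm hf hD) w₀ hw₀⟩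
    rw [finrank_layerSpace, coe_lossLipschitzConstant hs Lf 1 hA]
    push_cast
    field_simp
    simp
  · obtain ⟨N, M, hN, hM⟩ := exists_firstOrderAlgorithm (E := LayerSpace n i)
      (lossLipschitzConstant K n i s Lf (Real.toNNReal σ⁻¹) A) hΔ hδ hp hp1 hα
    refine ⟨N, M, hN.trans_eq ?_, fun ε _ B hB g hg W hW m hm D f hf hD w₀ hw₀ => ?_⟩
    -- The layers `i, …, K` contribute one factor `σ⁻¹` each.
    · have hpow : σ ^ (-(K : ℤ) + (i : ℤ) - 1) = σ⁻¹ ^ (K + 1 - i) := by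
        rw [inv_pow, ← zpow_natCast, ← zpow_neg]
        congr 1
        omega
      rw [finrank_layerSpace, coe_lossLipschitzConstant hs Lf _ hA,
        Real.coe_toNNReal _ (inv_pos.2 hσ).le, hpow]
      push_cast
      ring
    · simp only [normalizedDnn_eq_dnn] at hD
      rw [lossBN_eq_lossDnn] at hw₀ ⊢
      refine hM _ (lipschitzWith_lossDnn hi hiK (hn i hiK.le) hs hA (fun k hk hkK => ?_)
        hW hm hf hD) w₀ hw₀
      have h := (hg k hk hkK).comp
        (lipschitzWith_batchNorm (B k) hσ fun j => hB.2 ⟨k, hk, hkK, j, rfl⟩)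
      rwa [one_mul] at h
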